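/- Let $[n]=\{1,\dots,n\}$. The Hamming torus of dimension $d$ is the graph with vertex set $[n]^d$ in which two vertices are adjacent iff they differ in exactly one coordinate. Bootstrap percolation with threshold $\theta\in\mathbb N$ starts from a random set $\omega_0$ of open vertices, which contains every vertex independently with probability $p$; then $\omega_{j+1}$ consists of the vertices of $\omega_j$ together with all vertices that have at least $\theta$ neighbours in $\omega_j$, and $\omega_\infty=\bigcup_j\omega_j$. A plane is a set of $n^2$ vertices obtained by fixing all but two of the $d$ coordinates. The critical probability $p_c(2,d)$ (which also depends on $n$ and $\theta$) is the $p\in[0,1]$ for which $$\mathbb P_p(\text{there is a plane } F \text{ with } F\subseteq\omega_\infty)=\tfrac12 .$$ **Theorem 2.4.** Fix $d\ge 3$. There is $\theta_0=\theta_0(d)$ such that for every $\theta\ge\theta_0$ there is $n_0=n_0(d,\theta)$ such that for every $n\ge n_0$ there is exactly one such $p_c(2,d)$, and it satisfies $$n^{-1-\frac{2}{\theta}-\frac{4d^2+3}{\theta^{3/2}}}\;\le\; p_c(2,d)\;\le\; n^{-1-\frac{2}{\theta}-\frac{\sqrt{8(d-2.1)}}{\theta^{3/2}}}.$$ -/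

import Mathlib

namespace BootstrapPercolation

/-- The Hamming torus: the vertices are the points of `[n]^d`, and two vertices are adjacent iff
they differ in exactly one coordinate. -/
def hammingTorus (n d : ℕ) : SimpleGraph (Fin d → Fin n) where
  Adj v w := hammingDist v w = 1
  symm := ⟨fun v w h => by rwa [hammingDist_comm]⟩
  loopless := ⟨fun v h => by simp at h⟩

/-- One step of bootstrap percolation with threshold `θ` on the graph `G`: a vertex is open
afterwards iff it was open before or has at least `θ` open neighbours. A configuration is the
set of its open vertices. -/
def step {V : Type*} (G : SimpleGraph V) (θ : ℕ) (ω : Set V) : Set V :=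
  {v | v ∈ ω ∨ (θ : ℕ∞) ≤ (G.neighborSet v ∩ ω).encard}

/-- The configuration `ω_j` at time `j`, started from `ω_0 = ω`. -/
def configAt {V : Type*} (G : SimpleGraph V) (θ : ℕ) (ω : Set V) : ℕ → Set V
  | 0 => ω
  | j + 1 => step G θ (configAt G θ ω j)

/-- The final configuration `ω_∞`, the pointwise limit of the increasing sequence `ω_j`. -/
def finalConfig {V : Type*} (G : SimpleGraph V) (θ : ℕ) (ω : Set V) : Set V :=
  ⋃ j, configAt G θ ω j

/-- `S` is (the vertex set of) an `i`-dimensional subgraph of the Hamming torus: the coordinates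
in some set `I` of size `i` are free, and all the other coordinates are fixed. -/
def IsSubtorus (n d i : ℕ) (S : Set (Fin d → Fin n)) : Prop :=
  ∃ (I : Finset (Fin d)) (v : Fin d → Fin n), I.card = i ∧ S = {w | ∀ j, j ∉ I → w j = v j}

/-- The event that some `i`-dimensional subgraph of the Hamming torus is eventually open. -/
def eventuallyOpen (n d θ i : ℕ) : Set (Set (Fin d → Fin n)) :=
  {ω | ∃ S, IsSubtorus n d i S ∧ S ⊆ finalConfig (hammingTorus n d) θ ω}

/-- The probability that some `i`-dimensional subgraph is eventually open, when every vertex is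
initially open with probability `p`, independently of the others. -/
noncomputable def openProb (n d θ i : ℕ) (p : unitInterval) : ℝ :=
  (ProbabilityTheory.setBernoulli (Set.univ : Set (Fin d → Fin n)) p).real
    (eventuallyOpen n d θ i)

/-- `p` is the critical probability `p_c(i, d)`, for side length `n` and threshold `θ`. -/
def IsCriticalProb (n d θ i : ℕ) (p : unitInterval) : Prop :=
  openProb n d θ i p = 1 / 2

end BootstrapPercolation

/-! The probability of an open plane is continuous and strictly increasing in `p`, from 0 to 1. So
the critical value exists and is unique, and each bound amounts to comparing this probability with
1/2 at `p = n^(-1-a)`, where `a = 2/θ + c/θ^(3/2)`.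

Upper bound on `p_c`. Let `h = ⌈θ/2⌉`. A plane fills up if it has `h` rows, the `i`-th with `h - i`
open points, and `h` columns of the same kind: the deficit `i` of a line is made up by the `i` lines
completed before it (`GridClosed.fill`). A suitable row with `k` open points exists with probability
of order at least `min(1, n (np)^k) = n^(-max(0, ak-1))`, so a nucleus costs `n^(-2S)` with `S` the
sum of these exponents. There are `n^(d-2)` disjoint parallel planes, so `2S < d - 2` suffices.
Since `2S` is at most about `c²/8` for large `θ`, `c² = 8(d - 2.1)` works.

Lower bound on `p_c`. Call a vertex rich if it has at least `T` initially open neighbours, with `T`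
slightly below `θ`. If no plane contains `k` rich points in general position, the rich points of
each plane lie on few lines. Then the open points, rich points and lines with many rich points form
a closed set containing no plane (`NoRichMatching.notMem_openEvent`). Otherwise some `k` rich points
of a plane have `N = T - 2k` private open neighbours each. A union bound gives order `n^(d+2k)
(np)^(kN)`, which tends to 0 when `d + 2k < akN`. Taking `k` about `√θ/2` makes `c = 4d² + 3`
enough. -/

section BernoulliSubset
-- Random subsets of a finite set
open Finset

variable {V : Type*} [DecidableEq V]

/-- The probability that the random subset of `B` with density `p` equals `a ⊆ B`. -/
noncomputable def bernoulliWeight (p : ℝ) (B a : Finset V) : ℝ := p ^ #a * (1 - p) ^ #(B \ a)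

theorem bernoulliWeight_nonneg {p : ℝ} (h0 : 0 ≤ p) (h1 : p ≤ 1) (B a : Finset V) :
    0 ≤ bernoulliWeight p B a := by
  have : 0 ≤ 1 - p := by linarith
  unfold bernoulliWeight; positivity

theorem sum_bernoulliWeight (p : ℝ) (B : Finset V) :
    ∑ a ∈ B.powerset, bernoulliWeight p B a = 1 := by
  have h := Finset.sum_pow_mul_eq_add_pow p (1 - p) B
  rw [add_sub_cancel, one_pow] at h
  rw [← h]
  refine sum_congr rfl fun a ha => ?_
  rw [bernoulliWeight, card_sdiff_of_subset (mem_powerset.1 ha)]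

variable [Fintype V]

open scoped Classical in
/-- The probability that the random subset of `V` with density `p` lies in `E`. -/
noncomputable def bernoulliProb (p : ℝ) (E : Set (Finset V)) : ℝ :=
  ∑ s : Finset V, if s ∈ E then bernoulliWeight p univ s else 0

/-- Membership of `s` in `E` depends on `s ∩ B` only. -/
def DeterminedBy (E : Set (Finset V)) (B : Finset V) : Prop := ∀ s, s ∈ E ↔ s ∩ B ∈ E

namespace BernoulliSubset

variable {p : ℝ} {E E' : Set (Finset V)} {B B' : Finset V}

theorem prob_univ (p : ℝ) : bernoulliProb p (Set.univ : Set (Finset V)) = 1 := by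
  have := sum_bernoulliWeight p (univ : Finset V)
  simpa [bernoulliProb] using this

theorem prob_compl (p : ℝ) (E : Set (Finset V)) :
    bernoulliProb p Eᶜ = 1 - bernoulliProb p E := by
  rw [← prob_univ (V := V) p, eq_sub_iff_add_eq, bernoulliProb, bernoulliProb, bernoulliProb,
    ← sum_add_distrib]
  refine sum_congr rfl fun s _ => ?_
  by_cases h : s ∈ E <;> simp [h]

theorem prob_mono (h0 : 0 ≤ p) (h1 : p ≤ 1) (h : E ⊆ E') :
    bernoulliProb p E ≤ bernoulliProb p E' := by
  refine sum_le_sum fun s _ => ?_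
  have := bernoulliWeight_nonneg h0 h1 univ s
  by_cases hs : s ∈ E
  · simp [hs, h hs]
  · simp only [hs, if_false]; split_ifs <;> simp [this]

theorem prob_biUnion_le (h0 : 0 ≤ p) (h1 : p ≤ 1) {κ : Type*} (t : Finset κ)
    (E : κ → Set (Finset V)) :
    bernoulliProb p (⋃ i ∈ t, E i) ≤ ∑ i ∈ t, bernoulliProb p (E i) := by
  classical
  unfold bernoulliProb
  rw [sum_comm]
  refine sum_le_sum fun s _ => ?_
  have hw := bernoulliWeight_nonneg h0 h1 univ s
  split_ifs with h
  · simp only [Set.mem_iUnion] at h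
    obtain ⟨i, hi, hs⟩ := h
    refine le_trans ?_ (single_le_sum (fun j _ => ?_) hi)
    · simp [hs]
    · split_ifs <;> simp [hw]
  · exact sum_nonneg fun j _ => by split_ifs <;> simp [hw]

theorem union_inter_of_subset {a b B : Finset V} (ha : a ⊆ B) (hb : b ⊆ Bᶜ) :
    (a ∪ b) ∩ B = a := by
  rw [union_inter_distrib_right, inter_eq_left.2 ha,
    disjoint_iff_inter_eq_empty.1 (subset_compl_iff_disjoint_right.1 hb), union_empty]

theorem union_inter_compl_of_subset {a b B : Finset V} (ha : a ⊆ B) (hb : b ⊆ Bᶜ) :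
    (a ∪ b) ∩ Bᶜ = b := by
  rw [union_comm]
  exact union_inter_of_subset hb (by rwa [compl_compl])

/-- Fubini: the parts of the random set inside and outside `B` are independent. All the independence
statements rest on this. -/
theorem sum_split (p : ℝ) (B : Finset V) (f : Finset V → ℝ) :
    ∑ s : Finset V, bernoulliWeight p univ s * f s =
      ∑ a ∈ B.powerset, ∑ b ∈ Bᶜ.powerset,
        bernoulliWeight p B a * bernoulliWeight p Bᶜ b * f (a ∪ b) := by
  rw [← sum_product']
  refine sum_nbij' (fun s => (s ∩ B, s ∩ Bᶜ)) (fun x => x.1 ∪ x.2) ?_ ?_ ?_ ?_ ?_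
  · intro s _; simp [inter_subset_right]
  · intro _ _; simp
  · intro s _; simp [← inter_union_distrib_left]
  · rintro ⟨a, b⟩ h
    simp only [mem_product, mem_powerset] at h
    exact Prod.ext (union_inter_of_subset h.1 h.2) (union_inter_compl_of_subset h.1 h.2)
  · intro s _
    have e1 : #s = #(s ∩ B) + #(s ∩ Bᶜ) := by
      rw [← card_union_of_disjoint, ← inter_union_distrib_left, union_compl, inter_univ]
      exact disjoint_compl_right.mono inter_subset_right inter_subset_right
    have e2 : #(univ \ s) = #(B \ (s ∩ B)) + #(Bᶜ \ (s ∩ Bᶜ)) := by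
      rw [← card_union_of_disjoint]
      · congr 1; ext x; simp; tauto
      · exact disjoint_compl_right.mono sdiff_subset sdiff_subset
    have e3 : s ∩ B ∪ s ∩ Bᶜ = s := by rw [← inter_union_distrib_left, union_compl, inter_univ]
    simp only [bernoulliWeight, e3]
    rw [e1, e2, pow_add, pow_add]; ring

theorem prob_eq_sum (p : ℝ) (E : Set (Finset V)) :
    bernoulliProb p E = ∑ s : Finset V, bernoulliWeight p univ s * E.indicator 1 s := by
  classical
  simp [bernoulliProb, Set.indicator_apply]

theorem prob_of_determinedBy (p : ℝ) (h : DeterminedBy E B) :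
    bernoulliProb p E = ∑ a ∈ B.powerset, bernoulliWeight p B a * E.indicator 1 a := by
  classical
  rw [prob_eq_sum, sum_split p B]
  refine sum_congr rfl fun a ha => ?_
  rw [← mul_one (_ * _), ← sum_bernoulliWeight p Bᶜ, mul_sum]
  refine sum_congr rfl fun b hb => ?_
  have : (a ∪ b) ∩ B = a := union_inter_of_subset (mem_powerset.1 ha) (mem_powerset.1 hb)
  have : E.indicator (1 : Finset V → ℝ) (a ∪ b) = E.indicator 1 a := by
    simp only [Set.indicator_apply, Pi.one_apply]; rw [h (a ∪ b), this]
  rw [this]; ring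

omit [Fintype V] in
theorem _root_.DeterminedBy.mono (h : DeterminedBy E B) (hB : B ⊆ B') : DeterminedBy E B' := by
  intro s
  rw [h s, h (s ∩ B'), inter_assoc, inter_eq_right.2 hB]

omit [Fintype V] in
theorem _root_.DeterminedBy.compl (h : DeterminedBy E B) : DeterminedBy Eᶜ B :=
  fun s => not_congr (h s)

theorem prob_inter_compl (p : ℝ) (h : DeterminedBy E B) (h' : DeterminedBy E' Bᶜ) :
    bernoulliProb p (E ∩ E') = bernoulliProb p E * bernoulliProb p E' := by
  classical
  rw [prob_of_determinedBy p h, prob_of_determinedBy p h', sum_mul_sum, prob_eq_sum,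
    sum_split p B]
  refine sum_congr rfl fun a ha => sum_congr rfl fun b hb => ?_
  have e1 : (a ∪ b) ∩ B = a := union_inter_of_subset (mem_powerset.1 ha) (mem_powerset.1 hb)
  have e2 : (a ∪ b) ∩ Bᶜ = b := union_inter_compl_of_subset (mem_powerset.1 ha) (mem_powerset.1 hb)
  have : (E ∩ E').indicator (1 : Finset V → ℝ) (a ∪ b) = E.indicator 1 a * E'.indicator 1 b := by
    simp only [Set.indicator_apply, Set.mem_inter_iff]
    rw [h (a ∪ b), h' (a ∪ b), e1, e2]
    by_cases ha : a ∈ E <;> by_cases hb : b ∈ E' <;> simp [ha, hb]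
  rw [this]; ring

theorem prob_inter (p : ℝ) (h : DeterminedBy E B) (h' : DeterminedBy E' B')
    (hd : Disjoint B B') :
    bernoulliProb p (E ∩ E') = bernoulliProb p E * bernoulliProb p E' :=
  prob_inter_compl p h (h'.mono (subset_compl_iff_disjoint_left.2 hd))

section Family
variable {κ : Type*} {t : Finset κ} {F : κ → Set (Finset V)} {C : κ → Finset V}

omit [Fintype V] in
theorem determinedBy_biInter (h : ∀ i ∈ t, DeterminedBy (F i) (C i)) :
    DeterminedBy (⋂ i ∈ t, F i) (t.biUnion C) := by
  intro s
  simp only [Set.mem_iInter]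
  exact forall₂_congr fun i hi => (h i hi).mono (subset_biUnion_of_mem C hi) s

omit [Fintype V] in
theorem determinedBy_biUnion (h : ∀ i ∈ t, DeterminedBy (F i) (C i)) :
    DeterminedBy (⋃ i ∈ t, F i) (t.biUnion C) := by
  intro s
  simp only [Set.mem_iUnion, exists_prop]
  exact exists_congr fun i => and_congr_right fun hi =>
    (h i hi).mono (subset_biUnion_of_mem C hi) s

theorem prob_biInter (p : ℝ) (h : ∀ i ∈ t, DeterminedBy (F i) (C i))
    (hd : (t : Set κ).PairwiseDisjoint C) :
    bernoulliProb p (⋂ i ∈ t, F i) = ∏ i ∈ t, bernoulliProb p (F i) := by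
  classical
  induction t using Finset.induction_on with
  | empty => simp [prob_univ]
  | insert i t hi ih =>
    rw [prod_insert hi, Finset.set_biInter_insert,
      ← ih (fun j hj => h j (mem_insert_of_mem hj)) (hd.subset (by simp))]
    refine prob_inter p (h i (mem_insert_self i t))
      (determinedBy_biInter fun j hj => h j (mem_insert_of_mem hj)) ?_
    rw [disjoint_biUnion_right]
    intro j hj
    exact hd (by simp) (by simp [hj]) (by rintro rfl; exact hi hj)

theorem prob_biUnion (p : ℝ) (h : ∀ i ∈ t, DeterminedBy (F i) (C i))
    (hd : (t : Set κ).PairwiseDisjoint C) :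
    bernoulliProb p (⋃ i ∈ t, F i) = 1 - ∏ i ∈ t, (1 - bernoulliProb p (F i)) := by
  have e : (⋃ i ∈ t, F i) = (⋂ i ∈ t, (F i)ᶜ)ᶜ := by simp
  rw [e, prob_compl, prob_biInter p (fun i hi => (h i hi).compl) hd]
  simp [prob_compl]

end Family

omit [Fintype V] in
theorem determinedBy_mem (v : V) : DeterminedBy {s : Finset V | v ∈ s} {v} := fun s => by simp

theorem prob_mem (p : ℝ) (v : V) : bernoulliProb p {s : Finset V | v ∈ s} = p := by
  rw [prob_of_determinedBy p (determinedBy_mem v)]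
  have : ({v} : Finset V).powerset = {∅, {v}} := by ext; simp [subset_singleton_iff]
  simp [this, bernoulliWeight, Set.indicator_apply]

theorem prob_superset (p : ℝ) (S : Finset V) :
    bernoulliProb p {s : Finset V | S ⊆ s} = p ^ #S := by
  have e : {s : Finset V | S ⊆ s} = ⋂ v ∈ S, {s : Finset V | v ∈ s} := by
    ext s; simp [subset_iff]
  rw [e, prob_biInter (C := fun v => {v}) p fun v _ => determinedBy_mem v]
  · simp [prob_mem]
  · intro a _ b _ hab
    simpa [Function.onFun] using hab

theorem continuous_prob (E : Set (Finset V)) : Continuous fun p : ℝ => bernoulliProb p E := by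
  unfold bernoulliProb bernoulliWeight
  refine continuous_finsetSum _ fun s _ => ?_
  split_ifs <;> fun_prop

/-- Thinning: keeping each point of a density-`p` set with probability `q` gives density `p * q`. A
vertex outside `s` was either drawn and deleted, or never drawn; the binomial theorem on `sᶜ` sums
over these choices. -/
theorem weight_mul (p q : ℝ) (s : Finset V) :
    bernoulliWeight (p * q) univ s =
      ∑ t : Finset V, if s ⊆ t then bernoulliWeight p univ t * bernoulliWeight q t s else 0 := by
  rw [← sum_filter]
  have h := Finset.sum_pow_mul_eq_add_pow (p * (1 - q)) (1 - p) sᶜ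
  have e : p * (1 - q) + (1 - p) = 1 - p * q := by ring
  rw [bernoulliWeight, ← compl_eq_univ_sdiff, ← e, ← h, mul_sum]
  refine sum_nbij' (fun u => s ∪ u) (fun t => t \ s) ?_ ?_ ?_ ?_ ?_
  · intro u _; simp
  · intro t _; simp only [mem_powerset]; intro x; simp
  · intro u hu
    ext x
    have : x ∈ u → x ∈ sᶜ := fun h => mem_powerset.1 hu h
    simp at this ⊢; tauto
  · intro t ht
    exact union_sdiff_of_subset (by simpa using ht)
  · intro u hu
    rw [mem_powerset] at hu
    have hd : Disjoint s u := (subset_compl_iff_disjoint_left.1 hu)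
    have e1 : (s ∪ u) \ s = u := by rw [union_sdiff_left, hd.symm.sdiff_eq_left]
    have e2 : #(univ \ (s ∪ u)) = #sᶜ - #u := by
      rw [← card_sdiff_of_subset hu]; congr 1; ext x; simp
    rw [bernoulliWeight, bernoulliWeight, e1, e2, card_union_of_disjoint hd,
      mul_pow p q, mul_pow p (1 - q), pow_add]
    ring

/-- Couple the two densities by thinning, `p = p' * q` with `q < 1`. Deleting points can only leave
an up-set, and the full set is thinned to `∅ ∉ E` with positive probability, whence strictness. -/
theorem prob_strictMono {E : Set (Finset V)} (hE : IsUpperSet E) (h0 : ∅ ∉ E) (h1 : univ ∈ E)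
    {p p' : ℝ} (hp : 0 ≤ p) (hpp : p < p') (hp' : p' ≤ 1) :
    bernoulliProb p E < bernoulliProb p' E := by
  classical
  have hp0 : 0 < p' := hp.trans_lt hpp
  obtain ⟨q, rfl⟩ : ∃ q, p = p' * q := ⟨p / p', by field_simp⟩
  have hq0 : 0 ≤ q := by
    by_contra! h; nlinarith
  have hq1 : q < 1 := by
    by_contra! h; nlinarith
  have key : bernoulliProb (p' * q) E = ∑ t : Finset V, bernoulliWeight p' univ t *
      ∑ s ∈ t.powerset, bernoulliWeight q t s * E.indicator 1 s := by
    rw [prob_eq_sum]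
    simp_rw [weight_mul, sum_mul, mul_sum]
    rw [sum_comm]
    refine sum_congr rfl fun t _ => ?_
    rw [← sum_subset (subset_univ t.powerset)]
    · refine sum_congr rfl fun s hs => ?_
      rw [if_pos (mem_powerset.1 hs), mul_assoc]
    · intro s _ hs
      rw [if_neg (by simpa using hs), zero_mul]
  rw [key, prob_eq_sum]
  have hw : ∀ t s : Finset V, 0 ≤ bernoulliWeight q t s :=
    fun t s => bernoulliWeight_nonneg hq0 hq1.le t s
  have hle : ∀ t : Finset V, ∑ s ∈ t.powerset, bernoulliWeight q t s * E.indicator 1 s ≤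
      E.indicator 1 t := by
    intro t
    by_cases ht : t ∈ E
    · simp only [ht, Set.indicator_of_mem, Pi.one_apply]
      rw [← sum_bernoulliWeight q t]
      refine sum_le_sum fun s _ => mul_le_of_le_one_right (hw t s) ?_
      simp only [Set.indicator_apply]; split_ifs <;> simp
    · rw [Set.indicator_of_notMem ht]
      refine (sum_eq_zero fun s hs => ?_).le
      rw [Set.indicator_of_notMem fun h => ht (hE (mem_powerset.1 hs) h), mul_zero]
  refine sum_lt_sum
    (fun t _ => mul_le_mul_of_nonneg_left (hle t) (bernoulliWeight_nonneg hp0.le hp' _ _))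
    ⟨univ, mem_univ _, ?_⟩
  have hu : bernoulliWeight p' univ (univ : Finset V) = p' ^ #(univ : Finset V) := by
    simp [bernoulliWeight]
  rw [hu]
  refine mul_lt_mul_of_pos_left ?_ (by positivity)
  simp only [h1, Set.indicator_of_mem, Pi.one_apply]
  rw [← sum_bernoulliWeight q (univ : Finset V)]
  refine sum_lt_sum (fun s _ => mul_le_of_le_one_right (hw _ s) ?_) ⟨∅, by simp, ?_⟩
  · simp only [Set.indicator_apply]; split_ifs <;> simp
  · rw [Set.indicator_of_notMem h0, mul_zero]
    have : 0 < 1 - q := by linarith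
    simp only [bernoulliWeight, card_empty, pow_zero, one_mul]; positivity

theorem setBernoulli_real_eq (p : unitInterval) (A : Set (Set V)) :
    (ProbabilityTheory.setBernoulli (Set.univ : Set V) p).real A =
      bernoulliProb (p : ℝ) {s : Finset V | (s : Set V) ∈ A} := by
  classical
  have hA : A = ⋃ s ∈ (univ.filter fun s : Finset V => (s : Set V) ∈ A), {(s : Set V)} := by
    ext x
    simp only [mem_filter, mem_univ, true_and, Set.mem_iUnion, Set.mem_singleton_iff, exists_prop]
    constructor
    · intro h
      exact ⟨x.toFinite.toFinset, by simpa using h, by simp⟩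
    · rintro ⟨s, hs, rfl⟩; exact hs
  conv_lhs => rw [hA]
  rw [MeasureTheory.measureReal_biUnion_finset]
  · rw [bernoulliProb, ← sum_filter]
    refine sum_congr rfl fun s _ => ?_
    rw [ProbabilityTheory.setBernoulli_real_singleton p (Set.subset_univ _) Set.finite_univ,
      bernoulliWeight, Set.ncard_coe_finset, ← coe_univ, ← coe_sdiff, Set.ncard_coe_finset]
  · intro a _ b _ hab
    simpa [Function.onFun] using hab
  · intro s _
    exact MeasurableSet.singleton _

end BernoulliSubset
end BernoulliSubset
-- Monotonicity of the dynamics; existence and uniqueness of the critical probability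
namespace BootstrapPercolation

section Dynamics
variable {V : Type*} {G : SimpleGraph V} {θ : ℕ} {ω ω' C : Set V}

theorem subset_step (G : SimpleGraph V) (θ : ℕ) (ω : Set V) : ω ⊆ step G θ ω :=
  fun _ h => Or.inl h

theorem step_mono (h : ω ⊆ ω') : step G θ ω ⊆ step G θ ω' := by
  rintro v (hv | hv)
  · exact Or.inl (h hv)
  · exact Or.inr (hv.trans (Set.encard_le_encard (Set.inter_subset_inter_right _ h)))

theorem configAt_monotone (G : SimpleGraph V) (θ : ℕ) (ω : Set V) : Monotone (configAt G θ ω) :=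
  monotone_nat_of_le_succ fun _ => subset_step _ _ _

theorem finalConfig_mono (h : ω ⊆ ω') : finalConfig G θ ω ⊆ finalConfig G θ ω' := by
  refine Set.iUnion_mono fun j => ?_
  induction j with
  | zero => exact h
  | succ j ih => exact step_mono ih

theorem subset_finalConfig (G : SimpleGraph V) (θ : ℕ) (ω : Set V) : ω ⊆ finalConfig G θ ω :=
  Set.subset_iUnion (configAt G θ ω) 0

theorem finalConfig_subset_of_closed (h : ω ⊆ C)
    (hC : ∀ v ∉ C, (G.neighborSet v ∩ C).encard < θ) : finalConfig G θ ω ⊆ C := by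
  refine Set.iUnion_subset fun j => ?_
  induction j with
  | zero => exact h
  | succ j ih =>
    refine (step_mono ih).trans ?_
    rintro v (hv | hv)
    · exact hv
    · by_contra hvC
      exact (hC v hvC).not_ge hv

theorem mem_finalConfig_of_le_card {v : V} {A : Finset V} (hA : ∀ a ∈ A, a ∈ finalConfig G θ ω)
    (hadj : ∀ a ∈ A, G.Adj v a) (hcard : θ ≤ A.card) : v ∈ finalConfig G θ ω := by
  have h : ∀ a ∈ A, ∃ j, a ∈ configAt G θ ω j := fun a ha => Set.mem_iUnion.1 (hA a ha)
  choose! t ht using h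
  obtain ⟨j, hj⟩ : ∃ j, ∀ a ∈ A, a ∈ configAt G θ ω j :=
    -- Finitely many points are all open by the latest of their opening times.
    ⟨A.sup t, fun a ha => configAt_monotone G θ ω (Finset.le_sup ha) (ht a ha)⟩
  refine Set.mem_iUnion.2 ⟨j + 1, Or.inr ?_⟩
  calc (θ : ℕ∞) ≤ (A : Set V).encard := by rw [Set.encard_coe_eq_coe_finsetCard]; exact_mod_cast hcard
    _ ≤ (G.neighborSet v ∩ configAt G θ ω j).encard :=
      Set.encard_le_encard fun a ha => ⟨hadj a ha, hj a ha⟩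

end Dynamics

section Torus
variable {n d θ i : ℕ}

theorem hammingTorus_adj_iff {v w : Fin d → Fin n} :
    (hammingTorus n d).Adj v w ↔ ∃ j x, x ≠ v j ∧ w = Function.update v j x := by
  change hammingDist v w = 1 ↔ _
  rw [hammingDist, Finset.card_eq_one]
  constructor
  · rintro ⟨j, hj⟩
    have h (l : Fin d) : v l ≠ w l ↔ l = j := by
      have := Finset.ext_iff.1 hj l
      simpa using this
    refine ⟨j, w j, ((h j).2 rfl).symm, funext fun l => ?_⟩
    by_cases hl : l = j
    · subst hl; simp
    · rw [Function.update_of_ne hl]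
      exact (not_not.1 fun hne => hl ((h l).1 hne)).symm
  · rintro ⟨j, x, hx, rfl⟩
    refine ⟨j, Finset.ext fun l => ?_⟩
    by_cases hl : l = j
    · subst hl; simpa using hx.symm
    · simp [hl]

/-- The event that some `i`-dimensional subgraph is eventually open, for finite sets. -/
def openEvent (n d θ i : ℕ) : Set (Finset (Fin d → Fin n)) :=
  {s | (s : Set (Fin d → Fin n)) ∈ eventuallyOpen n d θ i}

theorem openProb_eq (p : unitInterval) :
    openProb n d θ i p = bernoulliProb (p : ℝ) (openEvent n d θ i) :=
  BernoulliSubset.setBernoulli_real_eq p _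

theorem isUpperSet_openEvent : IsUpperSet (openEvent n d θ i) := by
  rintro s t hst ⟨S, hS, hs⟩
  exact ⟨S, hS, hs.trans (finalConfig_mono (by exact_mod_cast hst))⟩

theorem empty_notMem_openEvent (hθ : 0 < θ) : ∅ ∉ openEvent n d θ i := by
  rintro ⟨S, ⟨I, v, -, rfl⟩, hS⟩
  have h : finalConfig (hammingTorus n d) θ ((∅ : Finset (Fin d → Fin n)) : Set _) ⊆ ∅ :=
    finalConfig_subset_of_closed (by simp) (fun _ _ => by simpa using hθ)
  exact h (hS fun _ _ => rfl : v ∈ _)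

theorem univ_mem_openEvent (hn : 0 < n) (hi : i ≤ d) : Finset.univ ∈ openEvent n d θ i := by
  obtain ⟨I, -, hI⟩ := Finset.exists_subset_card_eq (s := (Finset.univ : Finset (Fin d))) (by simpa using hi)
  refine ⟨_, ⟨I, fun _ => ⟨0, hn⟩, hI, rfl⟩, fun w _ => subset_finalConfig _ _ _ ?_⟩
  simp

theorem openProb_strictMono (hn : 0 < n) (hθ : 0 < θ) (hi : i ≤ d) :
    StrictMono (openProb n d θ i) := by
  intro p p' h
  rw [openProb_eq, openProb_eq]
  exact BernoulliSubset.prob_strictMono isUpperSet_openEvent (empty_notMem_openEvent hθ)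
    (univ_mem_openEvent hn hi) p.2.1 h p'.2.2

theorem existsUnique_isCriticalProb (hn : 0 < n) (hθ : 0 < θ) (hi : i ≤ d) :
    ∃! p : unitInterval, IsCriticalProb n d θ i p := by
  have hcont : Continuous (openProb n d θ i) := by
    have : openProb n d θ i = fun p : unitInterval => bernoulliProb (p : ℝ) (openEvent n d θ i) :=
      funext openProb_eq
    rw [this]
    exact (BernoulliSubset.continuous_prob _).comp continuous_subtype_val
  have h0 : openProb n d θ i 0 = 0 := by
    classical
    rw [openProb, ProbabilityTheory.setBernoulli_zero, MeasureTheory.measureReal_def,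
      MeasureTheory.Measure.dirac_apply]
    have := empty_notMem_openEvent (n := n) (d := d) (i := i) hθ
    simp only [openEvent, Set.mem_ofPred_eq, Finset.coe_empty] at this
    simp [this]
  have h1 : openProb n d θ i 1 = 1 := by
    classical
    rw [openProb, ProbabilityTheory.setBernoulli_one, MeasureTheory.measureReal_def,
      MeasureTheory.Measure.dirac_apply]
    have := univ_mem_openEvent (n := n) (d := d) (θ := θ) hn hi
    simp only [openEvent, Set.mem_ofPred_eq, Finset.coe_univ] at this
    simp [this]
  obtain ⟨p, -, hp⟩ := intermediate_value_Icc (a := (0 : unitInterval)) (b := 1) zero_le_one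
    hcont.continuousOn (show (1 / 2 : ℝ) ∈ _ by rw [h0, h1]; norm_num)
  exact ⟨p, hp, fun q hq => (openProb_strictMono hn hθ hi).injective (hq.trans hp.symm)⟩

end Torus
end BootstrapPercolation
-- Deterministic growth from a nucleus in a plane
namespace BootstrapPercolation
open Finset

section Grid
variable {α : Type*} [DecidableEq α] {θ h : ℕ}

/-- `P` is closed under bootstrap percolation with threshold `θ` on the grid `α × α`. -/
def GridClosed (θ : ℕ) (P : α → α → Prop) : Prop :=
  ∀ x y (A B : Finset α), (∀ a ∈ A, a ≠ x ∧ P a y) → (∀ b ∈ B, b ≠ y ∧ P x b) →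
    θ ≤ #A + #B → P x y

omit [DecidableEq α] in
theorem GridClosed.swap {P : α → α → Prop} (hP : GridClosed θ P) :
    GridClosed θ fun x y => P y x :=
  fun x y A B hA hB hc => hP y x B A hB hA (by omega)

variable {P : α → α → Prop} {ρ γ : ℕ → α} {R Q : ℕ → Finset α}

/-- The crossing of row `i` and column `j` sees `h - i` and `h - j` given points, plus `j` earlier
crossings in its row and `i` in its column: `2 * h` in all. Induction on `i + j` supplies the
earlier crossings. -/
theorem GridClosed.crossing (hP : GridClosed θ P) (hθ : θ ≤ 2 * h)
    (hρ : Set.InjOn ρ (Set.Iio h)) (hγ : Set.InjOn γ (Set.Iio h))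
    (hR : ∀ i < h, h - i ≤ #(R i)) (hQ : ∀ i < h, h - i ≤ #(Q i))
    (hRP : ∀ i < h, ∀ x ∈ R i, P x (ρ i)) (hQP : ∀ j < h, ∀ y ∈ Q j, P (γ j) y)
    (hRγ : ∀ i < h, ∀ j < h, γ j ∉ R i) (hQρ : ∀ i < h, ∀ j < h, ρ i ∉ Q j) :
    ∀ i < h, ∀ j < h, P (γ j) (ρ i) := by
  suffices H : ∀ N i j, i + j = N → i < h → j < h → P (γ j) (ρ i) from
    fun i hi j hj => H _ i j rfl hi hj
  intro N
  induction N using Nat.strong_induction_on with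
  | _ N ih =>
    intro i j hN hi hj
    refine hP _ _ (R i ∪ (range j).image γ) (Q j ∪ (range i).image ρ) ?_ ?_ ?_
    · intro a ha
      rcases mem_union.1 ha with ha | ha
      · exact ⟨fun e => hRγ i hi j hj (e ▸ ha), hRP i hi a ha⟩
      · obtain ⟨l, hl, rfl⟩ := mem_image.1 ha
        have hl := mem_range.1 hl
        exact ⟨fun e => hl.ne (hγ (hl.trans hj) hj e),
          ih (i + l) (by omega) i l rfl hi (hl.trans hj)⟩
    · intro a ha
      rcases mem_union.1 ha with ha | ha
      · exact ⟨fun e => hQρ i hi j hj (e ▸ ha), hQP j hj a ha⟩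
      · obtain ⟨l, hl, rfl⟩ := mem_image.1 ha
        have hl := mem_range.1 hl
        exact ⟨fun e => hl.ne (hρ (hl.trans hi) hi e),
          ih (l + j) (by omega) l j rfl (hl.trans hi) hj⟩
    · rw [card_union_of_disjoint, card_union_of_disjoint, card_image_of_injOn, card_image_of_injOn]
      · have := hR i hi; have := hQ j hj; simp only [card_range]; omega
      · exact hρ.mono fun l hl => (mem_range.1 hl).trans hi
      · exact hγ.mono fun l hl => (mem_range.1 hl).trans hj
      · rw [disjoint_right]
        intro a ha
        obtain ⟨l, hl, rfl⟩ := mem_image.1 ha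
        exact hQρ l ((mem_range.1 hl).trans hi) j hj
      · rw [disjoint_right]
        intro a ha
        obtain ⟨l, hl, rfl⟩ := mem_image.1 ha
        exact hRγ i hi l ((mem_range.1 hl).trans hj)

/-- A point of column `j` sees `h - j` given points and `h` crossings in its column, and the `j`
columns already filled along its row. -/
theorem GridClosed.columns (hP : GridClosed θ P) (hθ : θ ≤ 2 * h)
    (hρ : Set.InjOn ρ (Set.Iio h)) (hγ : Set.InjOn γ (Set.Iio h))
    (hQ : ∀ i < h, h - i ≤ #(Q i)) (hQP : ∀ j < h, ∀ y ∈ Q j, P (γ j) y)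
    (hQρ : ∀ i < h, ∀ j < h, ρ i ∉ Q j) (hX : ∀ i < h, ∀ j < h, P (γ j) (ρ i)) (y : α) :
    ∀ j < h, P (γ j) y := by
  intro j
  induction j using Nat.strong_induction_on with
  | _ j ih =>
    intro hj
    have hB : ∀ b ∈ Q j ∪ (range h).image ρ, P (γ j) b := by
      intro b hb
      rcases mem_union.1 hb with hb | hb
      · exact hQP j hj b hb
      · obtain ⟨l, hl, rfl⟩ := mem_image.1 hb
        exact hX l (mem_range.1 hl) j hj
    by_cases hy : y ∈ Q j ∪ (range h).image ρ
    · exact hB y hy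
    refine hP _ _ ((range j).image γ) (Q j ∪ (range h).image ρ) ?_
      (fun b hb => ⟨fun e => hy (e ▸ hb), hB b hb⟩) ?_
    · intro a ha
      obtain ⟨l, hl, rfl⟩ := mem_image.1 ha
      have hl := mem_range.1 hl
      exact ⟨fun e => hl.ne (hγ (hl.trans hj) hj e), ih l hl (hl.trans hj)⟩
    · rw [card_union_of_disjoint, card_image_of_injOn, card_image_of_injOn]
      · have := hQ j hj; simp only [card_range]; omega
      · exact hρ.mono fun l hl => mem_range.1 hl
      · exact hγ.mono fun l hl => (mem_range.1 hl).trans hj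
      · rw [disjoint_right]
        intro a ha
        obtain ⟨l, hl, rfl⟩ := mem_image.1 ha
        exact hQρ l (mem_range.1 hl) j hj

/-- Once `h` rows and `h` columns are full, every other point sees `2 * h ≥ θ` points on them. -/
theorem GridClosed.fill (hP : GridClosed θ P) (hθ : θ ≤ 2 * h)
    (hρ : Set.InjOn ρ (Set.Iio h)) (hγ : Set.InjOn γ (Set.Iio h))
    (hR : ∀ i < h, h - i ≤ #(R i)) (hQ : ∀ i < h, h - i ≤ #(Q i))
    (hRP : ∀ i < h, ∀ x ∈ R i, P x (ρ i)) (hQP : ∀ j < h, ∀ y ∈ Q j, P (γ j) y)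
    (hRγ : ∀ i < h, ∀ j < h, γ j ∉ R i) (hQρ : ∀ i < h, ∀ j < h, ρ i ∉ Q j) (x y : α) :
    P x y := by
  have hX := hP.crossing hθ hρ hγ hR hQ hRP hQP hRγ hQρ
  have hcol := fun y => hP.columns hθ hρ hγ hQ hQP hQρ hX y
  have hrow := fun x => hP.swap.columns hθ hγ hρ hR hRP
    (fun i hi j hj => hRγ j hj i hi) (fun i hi j hj => hX j hj i hi) x
  by_cases hx : x ∈ (range h).image γ
  · obtain ⟨l, hl, rfl⟩ := mem_image.1 hx
    exact hcol y l (mem_range.1 hl)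
  by_cases hy : y ∈ (range h).image ρ
  · obtain ⟨l, hl, rfl⟩ := mem_image.1 hy
    exact hrow x l (mem_range.1 hl)
  refine hP _ _ ((range h).image γ) ((range h).image ρ) ?_ ?_ ?_
  · intro a ha
    refine ⟨fun e => hx (e ▸ ha), ?_⟩
    obtain ⟨l, hl, rfl⟩ := mem_image.1 ha
    exact hcol y l (mem_range.1 hl)
  · intro a ha
    refine ⟨fun e => hy (e ▸ ha), ?_⟩
    obtain ⟨l, hl, rfl⟩ := mem_image.1 ha
    exact hrow x l (mem_range.1 hl)
  · rw [card_image_of_injOn, card_image_of_injOn]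
    · simp only [card_range]; omega
    · exact hρ.mono fun l hl => mem_range.1 hl
    · exact hγ.mono fun l hl => mem_range.1 hl

end Grid

section Cell
variable {n d θ : ℕ}

/-- The point of the plane through `w` in directions `c₀`, `c₁` with coordinates `x`, `y`. -/
def cell (c₀ c₁ : Fin d) (w : Fin d → Fin n) (x y : Fin n) : Fin d → Fin n :=
  Function.update (Function.update w c₀ x) c₁ y

variable {c₀ c₁ : Fin d} {w w' : Fin d → Fin n} {x x' y y' : Fin n}

theorem cell_fst (hc : c₀ ≠ c₁) : cell c₀ c₁ w x y c₀ = x := by simp [cell, hc]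

theorem cell_snd : cell c₀ c₁ w x y c₁ = y := by simp [cell]

theorem cell_of_ne {j : Fin d} (h0 : j ≠ c₀) (h1 : j ≠ c₁) : cell c₀ c₁ w x y j = w j := by
  simp [cell, h0, h1]

theorem cell_adj_fst (hc : c₀ ≠ c₁) (h : x' ≠ x) :
    (hammingTorus n d).Adj (cell c₀ c₁ w x y) (cell c₀ c₁ w x' y) := by
  refine hammingTorus_adj_iff.2 ⟨c₀, x', by rwa [cell_fst hc], ?_⟩
  rw [cell, cell, Function.update_comm hc.symm, Function.update_idem, Function.update_comm hc]

theorem cell_adj_snd (h : y' ≠ y) :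
    (hammingTorus n d).Adj (cell c₀ c₁ w x y) (cell c₀ c₁ w x y') := by
  refine hammingTorus_adj_iff.2 ⟨c₁, y', by rwa [cell_snd], ?_⟩
  rw [cell, cell, Function.update_idem]

theorem gridClosed_finalConfig (hc : c₀ ≠ c₁) (w : Fin d → Fin n) (ω : Set (Fin d → Fin n)) :
    GridClosed θ fun x y => cell c₀ c₁ w x y ∈ finalConfig (hammingTorus n d) θ ω := by
  intro x y A B hA hB hcard
  refine mem_finalConfig_of_le_card (A := A.image (fun a => cell c₀ c₁ w a y) ∪
    B.image (fun b => cell c₀ c₁ w x b)) ?_ ?_ ?_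
  · intro v hv
    rcases mem_union.1 hv with hv | hv <;> obtain ⟨a, ha, rfl⟩ := mem_image.1 hv
    · exact (hA a ha).2
    · exact (hB a ha).2
  · intro v hv
    rcases mem_union.1 hv with hv | hv <;> obtain ⟨a, ha, rfl⟩ := mem_image.1 hv
    · exact cell_adj_fst hc (hA a ha).1
    · exact cell_adj_snd (hB a ha).1
  · rw [card_union_of_disjoint, card_image_of_injective, card_image_of_injective]
    · exact hcard
    · intro b b' e
      simpa [cell_snd] using congrFun e c₁
    · intro b b' e
      simpa [cell_fst hc] using congrFun e c₀
    · rw [disjoint_left]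
      intro v hv hv'
      obtain ⟨a, ha, rfl⟩ := mem_image.1 hv
      obtain ⟨b, hb, e⟩ := mem_image.1 hv'
      refine (hA a ha).1 ?_
      simpa [cell_fst hc] using (congrFun e c₀).symm

theorem isSubtorus_cells (hc : c₀ ≠ c₁) (w : Fin d → Fin n) :
    IsSubtorus n d 2 {v | ∃ x y, v = cell c₀ c₁ w x y} := by
  refine ⟨{c₀, c₁}, w, card_pair hc, Set.ext fun v => ⟨?_, fun h => ⟨v c₀, v c₁, ?_⟩⟩⟩
  · rintro ⟨x, y, rfl⟩ j hj
    simp only [mem_insert, mem_singleton, not_or] at hj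
    exact cell_of_ne hj.1 hj.2
  · funext j
    by_cases h1 : j = c₁
    · subst h1; rw [cell_snd]
    by_cases h0 : j = c₀
    · subst h0; rw [cell_fst hc]
    rw [cell_of_ne h0 h1]
    exact h j (by simp [h0, h1])

end Cell
end BootstrapPercolation
-- Probability of a nucleus
namespace BootstrapPercolation
open Finset

section Blocks
variable {n b h m : ℕ}

/-- The `m`-th block of `b` consecutive elements of `Fin n`. -/
def block (n b m : ℕ) : Finset (Fin n) := univ.filter fun x => x.val / b = m

/-- The elements of `Fin n` beyond the first `h` blocks. -/
def highPart (n b h : ℕ) : Finset (Fin n) := univ.filter fun x => h ≤ x.val / b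

/-- The elements of `Fin n` in the first `h` blocks. -/
def lowPart (n b h : ℕ) : Finset (Fin n) := univ.filter fun x => x.val / b < h

theorem mem_block {x : Fin n} : x ∈ block n b m ↔ x.val / b = m := by simp [block]

theorem mem_highPart {x : Fin n} : x ∈ highPart n b h ↔ h ≤ x.val / b := by simp [highPart]

theorem mem_lowPart {x : Fin n} : x ∈ lowPart n b h ↔ x.val / b < h := by simp [lowPart]

theorem card_block (hb : 0 < b) (hm : (m + 1) * b ≤ n) : #(block n b m) = b := by
  have e : (block n b m).map Fin.valEmbedding = Ico (m * b) ((m + 1) * b) := by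
    ext x
    simp only [mem_map, mem_block, Fin.valEmbedding_apply, mem_Ico]
    constructor
    · rintro ⟨y, hy, rfl⟩
      rw [Nat.div_eq_iff hb] at hy
      rw [add_mul]; omega
    · intro hx
      refine ⟨⟨x, hx.2.trans_le hm⟩, (Nat.div_eq_iff hb).2 ?_, rfl⟩
      rw [add_mul] at hx; dsimp only; omega
  rw [← card_map Fin.valEmbedding, e, Nat.card_Ico, add_mul, one_mul, Nat.add_sub_cancel_left]

end Blocks

section HalfNucleation
variable {V : Type*} [DecidableEq V] [Fintype V] {n b h m k : ℕ} {p : ℝ}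
  {g : Fin n → Fin n → V} {y : Fin n}

/-- The line `y` has an open point in the `m`-th block. -/
def blockEvent (g : Fin n → Fin n → V) (b m : ℕ) (y : Fin n) : Set (Finset V) :=
  ⋃ x ∈ block n b m, {s | g x y ∈ s}

/-- The line `y` has open points in `k` consecutive blocks, starting from the `h`-th. -/
def lineEvent (g : Fin n → Fin n → V) (b h k : ℕ) (y : Fin n) : Set (Finset V) :=
  ⋂ l ∈ range k, blockEvent g b (h + l) y

/-- Among the lines of the `i`-th block there is one with `h - i` open points, for all `i < h`. -/
def halfNucleation (g : Fin n → Fin n → V) (b h : ℕ) : Set (Finset V) :=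
  ⋂ i ∈ range h, ⋃ y ∈ block n b i, lineEvent g b h (h - i) y

omit [Fintype V] in
theorem image₂_disjoint_right {A B B' : Finset (Fin n)} (hg : Function.Injective2 g)
    (hB : Disjoint B B') : Disjoint (image₂ g A B) (image₂ g A B') := by
  rw [disjoint_left] at hB ⊢
  intro v hv hv'
  obtain ⟨x, hx, y, hy, rfl⟩ := mem_image₂.1 hv
  obtain ⟨x', hx', y', hy', e⟩ := mem_image₂.1 hv'
  obtain ⟨rfl, rfl⟩ := hg e
  exact hB hy hy'

omit [Fintype V] in
theorem image₂_disjoint_left {A A' B : Finset (Fin n)} (hg : Function.Injective2 g)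
    (hA : Disjoint A A') : Disjoint (image₂ g A B) (image₂ g A' B) := by
  rw [disjoint_left] at hA ⊢
  intro v hv hv'
  obtain ⟨x, hx, y, hy, rfl⟩ := mem_image₂.1 hv
  obtain ⟨x', hx', y', hy', e⟩ := mem_image₂.1 hv'
  obtain ⟨rfl, rfl⟩ := hg e
  exact hA hx hx'

theorem block_disjoint {m m' : ℕ} (hm : m ≠ m') : Disjoint (block n b m) (block n b m') := by
  rw [disjoint_left]
  intro x hx hx'
  rw [mem_block] at hx hx'
  exact hm (hx.symm.trans hx')

omit [Fintype V] in
theorem biUnion_singleton_eq_image₂ (g : Fin n → Fin n → V) (A : Finset (Fin n)) (y : Fin n) :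
    (A.biUnion fun x => {g x y}) = image₂ g A {y} := by
  ext v; simp [eq_comm]

omit [Fintype V] in
theorem determinedBy_blockEvent :
    DeterminedBy (blockEvent g b m y) (image₂ g (block n b m) {y}) := by
  rw [← biUnion_singleton_eq_image₂]
  exact BernoulliSubset.determinedBy_biUnion fun x _ => BernoulliSubset.determinedBy_mem _

theorem prob_blockEvent (hg : Function.Injective2 g) (hb : 0 < b) (hm : (m + 1) * b ≤ n) :
    bernoulliProb p (blockEvent g b m y) = 1 - (1 - p) ^ b := by
  rw [blockEvent, BernoulliSubset.prob_biUnion p (C := fun x => {g x y})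
    fun x _ => BernoulliSubset.determinedBy_mem _]
  · simp [BernoulliSubset.prob_mem, card_block hb hm]
  · intro x _ x' _ hx
    simpa [Function.onFun] using fun e => hx (hg e).1

omit [Fintype V] in
theorem determinedBy_lineEvent :
    DeterminedBy (lineEvent g b h k y) (image₂ g (highPart n b h) {y}) := by
  refine (BernoulliSubset.determinedBy_biInter fun l _ => determinedBy_blockEvent).mono ?_
  refine biUnion_subset.2 fun l _ => image₂_subset_right fun x hx => ?_
  rw [mem_block] at hx
  rw [mem_highPart]; omega

theorem prob_lineEvent (hg : Function.Injective2 g) (hb : 0 < b) (hk : (h + k) * b ≤ n) :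
    bernoulliProb p (lineEvent g b h k y) = (1 - (1 - p) ^ b) ^ k := by
  rw [lineEvent, BernoulliSubset.prob_biInter p fun l _ => determinedBy_blockEvent]
  · rw [prod_congr rfl fun l hl => prob_blockEvent hg hb ?_, prod_const, card_range]
    refine le_trans (Nat.mul_le_mul_right b ?_) hk
    have := mem_range.1 hl; omega
  · intro l _ l' _ hl
    exact image₂_disjoint_left hg (block_disjoint (by omega))

omit [Fintype V] in
theorem determinedBy_biUnion_lineEvent (A : Finset (Fin n)) :
    DeterminedBy (⋃ y ∈ A, lineEvent g b h k y) (image₂ g (highPart n b h) A) := by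
  refine (BernoulliSubset.determinedBy_biUnion fun l _ => determinedBy_lineEvent).mono ?_
  exact biUnion_subset.2 fun l hl => image₂_subset_left (by simpa using hl)

theorem prob_biUnion_lineEvent (hg : Function.Injective2 g) (hb : 0 < b)
    (hk : (h + k) * b ≤ n) (hm : (m + 1) * b ≤ n) :
    bernoulliProb p (⋃ y ∈ block n b m, lineEvent g b h k y) =
      1 - (1 - (1 - (1 - p) ^ b) ^ k) ^ b := by
  rw [BernoulliSubset.prob_biUnion p fun l _ => determinedBy_lineEvent]
  · simp [prob_lineEvent hg hb hk, card_block hb hm]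
  · intro l _ l' _ hl
    exact image₂_disjoint_right hg (by simpa using hl)

omit [Fintype V] in
theorem determinedBy_halfNucleation :
    DeterminedBy (halfNucleation g b h) (image₂ g (highPart n b h) (lowPart n b h)) := by
  refine (BernoulliSubset.determinedBy_biInter fun l _ => determinedBy_biUnion_lineEvent _).mono ?_
  refine biUnion_subset.2 fun l hl => image₂_subset_left fun x hx => ?_
  rw [mem_block] at hx
  rw [mem_lowPart, hx]
  exact mem_range.1 hl

/-- Using a separate block for each row index, and for each open point wanted on a row, makes all
the events independent, so the probability is an exact product. -/
theorem prob_halfNucleation (hg : Function.Injective2 g) (hb : 0 < b) (hn : 2 * h * b ≤ n) :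
    bernoulliProb p (halfNucleation g b h) =
      ∏ i ∈ range h, (1 - (1 - (1 - (1 - p) ^ b) ^ (h - i)) ^ b) := by
  rw [halfNucleation,
    BernoulliSubset.prob_biInter p fun l _ => determinedBy_biUnion_lineEvent _]
  · refine prod_congr rfl fun i hi => prob_biUnion_lineEvent hg hb ?_ ?_
    · exact le_trans (Nat.mul_le_mul_right b (by omega)) hn
    · have := mem_range.1 hi
      exact le_trans (Nat.mul_le_mul_right b (by omega)) hn
  · intro l _ l' _ hl
    exact image₂_disjoint_right hg (block_disjoint hl)

omit [Fintype V] [DecidableEq V] in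
theorem exists_lines_of_mem_halfNucleation [Nonempty (Fin n)] {s : Finset V} (hs : s ∈ halfNucleation g b h) :
    ∃ (ρ : ℕ → Fin n) (R : ℕ → Finset (Fin n)), ∀ i < h, (ρ i).val / b = i ∧ h - i ≤ #(R i) ∧
      ∀ x ∈ R i, g x (ρ i) ∈ s ∧ h ≤ x.val / b := by
  have H : ∀ i < h, ∃ y : Fin n, y.val / b = i ∧
      ∀ l < h - i, ∃ x : Fin n, x.val / b = h + l ∧ g x y ∈ s := by
    simpa [halfNucleation, lineEvent, blockEvent, mem_block] using hs
  choose! ρ hρ hx using H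
  choose! x hx hxs using hx
  refine ⟨ρ, fun i => (range (h - i)).image (x i), fun i hi => ⟨hρ i hi, ?_, ?_⟩⟩
  · rw [card_image_of_injOn, card_range]
    intro l hl l' hl' e
    have h1 := hx i hi l (mem_range.1 hl)
    have h2 := hx i hi l' (mem_range.1 hl')
    rw [e, h2] at h1
    omega
  · intro z hz
    obtain ⟨l, hl, rfl⟩ := mem_image.1 hz
    rw [hx i hi l (mem_range.1 hl)]
    exact ⟨hxs i hi l (mem_range.1 hl), Nat.le_add_right _ _⟩

end HalfNucleation

section Nucleation
variable {n d θ b h : ℕ} {c₀ c₁ : Fin d} {p : ℝ} {w : Fin d → Fin n}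

/-- The plane through `w` in directions `c₀`, `c₁` contains a nucleus. -/
def nucleation (c₀ c₁ : Fin d) (b h : ℕ) (w : Fin d → Fin n) : Set (Finset (Fin d → Fin n)) :=
  halfNucleation (fun x y => cell c₀ c₁ w x y) b h ∩
    halfNucleation (fun x y => cell c₀ c₁ w y x) b h

theorem injective2_cell (hc : c₀ ≠ c₁) : Function.Injective2 (cell c₀ c₁ w) := by
  intro x x' y y' e
  have h0 := congrFun e c₀
  have h1 := congrFun e c₁
  rw [cell_fst hc, cell_fst hc] at h0
  rw [cell_snd, cell_snd] at h1
  exact ⟨h0, h1⟩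

theorem nucleation_subset_openEvent (hc : c₀ ≠ c₁) (hθ : θ ≤ 2 * h) :
    nucleation c₀ c₁ b h w ⊆ openEvent n d θ 2 := by
  rintro s ⟨h0, h1⟩
  refine ⟨_, isSubtorus_cells hc w, ?_⟩
  rintro _ ⟨x, y, rfl⟩
  have : Nonempty (Fin n) := ⟨x⟩
  obtain ⟨ρ, R, hR⟩ := exists_lines_of_mem_halfNucleation h0
  obtain ⟨γ, Q, hQ⟩ := exists_lines_of_mem_halfNucleation h1
  refine (gridClosed_finalConfig hc w (s : Set (Fin d → Fin n))).fill hθ (ρ := ρ) (γ := γ)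
    (R := R) (Q := Q) ?_ ?_ (fun i hi => (hR i hi).2.1) (fun i hi => (hQ i hi).2.1)
    (fun i hi x hx => subset_finalConfig _ _ _ ((hR i hi).2.2 x hx).1)
    (fun i hi x hx => subset_finalConfig _ _ _ ((hQ i hi).2.2 x hx).1) ?_ ?_ x y
  · intro i hi j hj e
    rw [← (hR i hi).1, e, (hR j hj).1]
  · intro i hi j hj e
    rw [← (hQ i hi).1, e, (hQ j hj).1]
  · intro i hi j hj hm
    have := ((hR i hi).2.2 _ hm).2
    rw [(hQ j hj).1] at this
    omega
  · intro i hi j hj hm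
    have := ((hQ j hj).2.2 _ hm).2
    rw [(hR i hi).1] at this
    omega

theorem determinedBy_nucleation :
    DeterminedBy (nucleation c₀ c₁ b h w) (image₂ (cell c₀ c₁ w) univ univ) := by
  intro s
  refine and_congr (determinedBy_halfNucleation.mono ?_ s)
    (determinedBy_halfNucleation.mono ?_ s)
  · exact image₂_subset (subset_univ _) (subset_univ _)
  · intro v hv
    obtain ⟨x, -, y, -, rfl⟩ := mem_image₂.1 hv
    exact mem_image₂_of_mem (mem_univ _) (mem_univ _)

/-- The row half depends on the rectangle high × low and the column half on low × high. These are
disjoint, so the probability is a square. -/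
theorem prob_nucleation (hc : c₀ ≠ c₁) (hb : 0 < b) (hn : 2 * h * b ≤ n) :
    bernoulliProb p (nucleation c₀ c₁ b h w) =
      (∏ i ∈ range h, (1 - (1 - (1 - (1 - p) ^ b) ^ (h - i)) ^ b)) ^ 2 := by
  have hg : Function.Injective2 (cell c₀ c₁ w) := injective2_cell hc
  rw [nucleation, BernoulliSubset.prob_inter p determinedBy_halfNucleation
    determinedBy_halfNucleation, prob_halfNucleation hg hb hn,
    prob_halfNucleation (fun _ _ _ _ e => (hg e).symm) hb hn, sq]
  rw [disjoint_left]
  intro v hv hv'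
  obtain ⟨x, hx, y, hy, rfl⟩ := mem_image₂.1 hv
  obtain ⟨x', hx', y', hy', e⟩ := mem_image₂.1 hv'
  obtain ⟨rfl, rfl⟩ := hg e
  rw [mem_highPart] at hx
  rw [mem_lowPart] at hy'
  omega

theorem le_prob_openEvent (hd : 2 ≤ d) (hb : 0 < b) (hn : 2 * h * b ≤ n) (hn0 : 0 < n)
    (hθ : θ ≤ 2 * h) (hp0 : 0 ≤ p) (hp1 : p ≤ 1) :
    1 - (1 - (∏ i ∈ range h, (1 - (1 - (1 - (1 - p) ^ b) ^ (h - i)) ^ b)) ^ 2) ^ (n ^ (d - 2)) ≤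
      bernoulliProb p (openEvent n d θ 2) := by
  set c₀ : Fin d := ⟨0, by omega⟩
  set c₁ : Fin d := ⟨1, by omega⟩
  have hc : c₀ ≠ c₁ := by simp [c₀, c₁]
  -- One base point for each of the `n ^ (d - 2)` parallel planes in directions `c₀`, `c₁`.
  set W : Finset (Fin d → Fin n) := Fintype.piFinset fun j =>
    if j ∈ ({c₀, c₁} : Finset (Fin d)) then {⟨0, hn0⟩} else univ with hW
  have hcard : #W = n ^ (d - 2) := by
    rw [hW, Fintype.card_piFinset]
    have : ∀ j, #(if j ∈ ({c₀, c₁} : Finset (Fin d)) then {⟨0, hn0⟩} else (univ : Finset (Fin n))) =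
        if j ∈ ({c₀, c₁} : Finset (Fin d)) then 1 else n := by
      intro j; split_ifs <;> simp
    simp_rw [this]
    rw [prod_ite, prod_const_one, one_mul, prod_const, filter_not, filter_mem_eq_inter,
      univ_inter, card_sdiff_of_subset (subset_univ _), card_pair hc]
    simp
  rw [← hcard, ← prod_const]
  refine le_trans (le_of_eq ?_) (BernoulliSubset.prob_mono hp0 hp1 <|
    (Set.iUnion₂_subset fun w _ => nucleation_subset_openEvent hc hθ :
      (⋃ w ∈ W, nucleation c₀ c₁ b h w) ⊆ openEvent n d θ 2))
  rw [BernoulliSubset.prob_biUnion p fun w _ => determinedBy_nucleation]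
  · congr 1
    exact prod_congr rfl fun w _ => by rw [prob_nucleation hc hb hn]
  · intro w hw w' hw' hne
    simp only [Function.onFun]
    rw [disjoint_left]
    intro v hv hv'
    obtain ⟨x, -, y, -, rfl⟩ := mem_image₂.1 hv
    obtain ⟨x', -, y', -, e⟩ := mem_image₂.1 hv'
    refine hne (funext fun j => ?_)
    rw [hW, mem_coe, Fintype.mem_piFinset] at hw hw'
    have a1 := hw j
    have a2 := hw' j
    by_cases hj : j ∈ ({c₀, c₁} : Finset (Fin d))
    · rw [if_pos hj, mem_singleton] at a1 a2
      rw [a1, a2]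
    · simp only [mem_insert, mem_singleton, not_or] at hj
      have := congrFun e j
      rw [cell_of_ne hj.1 hj.2, cell_of_ne hj.1 hj.2] at this
      exact this.symm

end Nucleation
end BootstrapPercolation
-- Asymptotics of the nucleation bound
namespace BootstrapPercolation
open Finset Filter

/-- With `t = b * x`, `(1 - x) ^ b ≤ exp (-t) ≤ 1 / (1 + t)`, and `t / (1 + t) ≥ min 1 t / 2`. This
is a converse to the union bound, up to a factor 2. -/
theorem half_min_le_one_sub_one_sub_pow {x : ℝ} (h0 : 0 ≤ x) (h1 : x ≤ 1) (b : ℕ) :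
    min 1 (b * x) / 2 ≤ 1 - (1 - x) ^ b := by
  have ht : 0 ≤ b * x := by positivity
  have hexp : (1 - x) ^ b ≤ Real.exp (-(b * x)) := by
    rw [← mul_neg, Real.exp_nat_mul]
    exact pow_le_pow_left₀ (by linarith) (by linarith [Real.add_one_le_exp (-x)]) b
  have hinv : Real.exp (-(b * x)) ≤ (1 + b * x)⁻¹ := by
    rw [Real.exp_neg]
    exact inv_anti₀ (by positivity) (by linarith [Real.add_one_le_exp (b * x)])
  have hle : min 1 (b * x) / 2 ≤ 1 - (1 + b * x)⁻¹ := by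
    have e : 1 - (1 + b * x)⁻¹ = b * x / (1 + b * x) := by field_simp; ring
    rw [e, div_le_div_iff₀ two_pos (by positivity)]
    rcases le_total (b * x) 1 with h | h
    · rw [min_eq_right h]; nlinarith
    · rw [min_eq_left h]; nlinarith
  linarith

theorem half_lt_one_sub_one_sub_pow {q : ℝ} {N : ℕ} (h1 : q ≤ 1) (hN : 1 ≤ N * q) :
    1 / 2 < 1 - (1 - q) ^ N := by
  have hexp : (1 - q) ^ N ≤ Real.exp (-(N * q)) := by
    rw [← mul_neg, Real.exp_nat_mul]
    exact pow_le_pow_left₀ (by linarith) (by linarith [Real.add_one_le_exp (-q)]) N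
  have : Real.exp (-(N * q)) ≤ Real.exp (-1) := Real.exp_le_exp.2 (by linarith)
  have : Real.exp (-1) < 1 / 2 := by
    have := Real.exp_neg_one_lt_d9
    linarith
  linarith

/-- Comparison of the sum with the integral of `max 0 (a * x - 1)`; the last term is the largest
summand. The induction removes that summand, `i = 0`. -/
theorem sum_max_le {a : ℝ} (ha : 0 < a) (h : ℕ) :
    ∑ i ∈ range h, max 0 (a * ((h - i : ℕ) : ℝ) - 1) ≤
      max 0 (a * h - 1) ^ 2 / (2 * a) + max 0 (a * h - 1) := by
  induction h with
  | zero => simp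
  | succ h ih =>
    rw [sum_range_succ']
    simp only [Nat.add_sub_add_right, Nat.sub_zero]
    refine (add_le_add_left ih _).trans ?_
    push_cast
    set x := a * h - 1 with hx
    have e : a * (h + 1 : ℝ) - 1 = x + a := by rw [hx]; ring
    rw [e]
    have key : max 0 x ^ 2 / (2 * a) + max 0 x ≤ max 0 (x + a) ^ 2 / (2 * a) := by
      rw [← sub_nonneg]
      rcases le_total 0 x with h0 | h0
      · rw [max_eq_right h0, max_eq_right (by linarith)]
        have : (x + a) ^ 2 / (2 * a) - (x ^ 2 / (2 * a) + x) = a / 2 := by field_simp; ring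
        rw [this]; positivity
      · rw [max_eq_left h0]
        have : 0 ≤ max 0 (x + a) ^ 2 / (2 * a) := by positivity
        simpa using this
    linarith

theorem eventually_half_lt_prob_openEvent {d θ h : ℕ} (hd : 2 ≤ d) (hh : 0 < h) (hθ : θ ≤ 2 * h)
    {a : ℝ} (ha : 0 < a)
    (hS : 2 * ∑ i ∈ range h, max 0 (a * ((h - i : ℕ) : ℝ) - 1) < d - 2) :
    ∀ᶠ n : ℕ in atTop,
      1 / 2 < bernoulliProb ((n : ℝ) ^ (-1 - a)) (openEvent n d θ 2) := by
  set S := ∑ i ∈ range h, max 0 (a * ((h - i : ℕ) : ℝ) - 1)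
  -- Chosen so that `b ≥ n / (4 * h)` gives both `u ≥ b * p / 2 ≥ κ * n ^ (-a)` and `b ≥ κ * n`; at
  -- most `h + 1` factors `κ` are lost per row.
  set κ : ℝ := 1 / (8 * h) with hκ
  have hh1 : (1 : ℝ) ≤ h := by exact_mod_cast hh
  have hκ0 : 0 < κ := by positivity
  have hκ1 : κ ≤ 1 := by
    rw [hκ, div_le_one (by positivity)]; linarith
  set K : ℝ := ((κ ^ (h + 1) / 2) ^ h) ^ 2
  have hK : 0 < K := by positivity
  have hlim : Tendsto (fun n : ℕ => K * (n : ℝ) ^ ((d : ℝ) - 2 - 2 * S)) atTop atTop :=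
    ((tendsto_rpow_atTop (by linarith)).comp tendsto_natCast_atTop_atTop).const_mul_atTop hK
  filter_upwards [hlim.eventually_ge_atTop 1, eventually_ge_atTop (2 * h)] with n hn1 hn
  have hn0 : 0 < n := by omega
  have hnR : (1 : ℝ) ≤ n := by exact_mod_cast hn0
  have hnpos : (0 : ℝ) < n := by linarith
  set p : ℝ := (n : ℝ) ^ (-1 - a) with hp
  have hp0 : 0 ≤ p := by positivity
  have hp1 : p ≤ 1 := Real.rpow_le_one_of_one_le_of_nonpos hnR (by linarith)
  set b := n / (2 * h) with hb
  have hb0 : 0 < b := Nat.div_pos hn (by omega)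
  have hbn : 2 * h * b ≤ n := Nat.mul_div_le _ _
  have hbR : (n : ℝ) ≤ 4 * h * b := by
    have h1 : n < 2 * h * (b + 1) := Nat.lt_mul_div_succ n (by omega)
    have h2 : 2 * h * (b + 1) ≤ 4 * h * b := by nlinarith
    exact_mod_cast h1.le.trans h2
  have hbR' : (b : ℝ) ≤ n := by
    have : b ≤ n := Nat.div_le_self _ _
    exact_mod_cast this
  have hnp : n * p = (n : ℝ) ^ (-a) := by
    rw [hp]; nth_rewrite 1 [← Real.rpow_one (n : ℝ)]
    rw [← Real.rpow_add hnpos]; congr 1; ring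
  set u := 1 - (1 - p) ^ b with hu
  have hpb : (1 - p) ^ b ∈ Set.Icc (0 : ℝ) 1 :=
    ⟨pow_nonneg (by linarith) _, pow_le_one₀ (by linarith) (by linarith)⟩
  have hu1 : u ≤ 1 := by linarith [hpb.1]
  have hu0 : 0 ≤ u := by linarith [hpb.2]
  have huκ : κ * (n : ℝ) ^ (-a) ≤ u := by
    refine le_trans ?_ (half_min_le_one_sub_one_sub_pow hp0 hp1 b)
    have h1 : b * p ≤ 1 := by
      calc b * p ≤ n * p := by gcongr
        _ = (n : ℝ) ^ (-a) := hnp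
        _ ≤ 1 := Real.rpow_le_one_of_one_le_of_nonpos hnR (by linarith)
    rw [min_eq_right h1, ← hnp, hκ, div_mul_eq_mul_div, one_mul,
      div_le_div_iff₀ (by positivity) two_pos]
    nlinarith
  have hfactor : ∀ i ∈ range h, κ ^ (h + 1) / 2 *
      (n : ℝ) ^ (-max 0 (a * ((h - i : ℕ) : ℝ) - 1)) ≤ 1 - (1 - u ^ (h - i)) ^ b := by
    intro i _
    set k := h - i
    have hk : k ≤ h := Nat.sub_le _ _
    refine le_trans ?_ (half_min_le_one_sub_one_sub_pow (pow_nonneg hu0 k)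
      (pow_le_one₀ hu0 hu1) b)
    rw [div_mul_eq_mul_div]
    gcongr
    have hκh : κ ^ (h + 1) ≤ 1 := pow_le_one₀ hκ0.le hκ1
    refine le_min ?_ ?_
    · refine mul_le_one₀ hκh (by positivity) ?_
      exact Real.rpow_le_one_of_one_le_of_nonpos hnR (by simp)
    · have h1 : κ ^ k * (n : ℝ) ^ (-(a * k)) ≤ u ^ k := by
        have := pow_le_pow_left₀ (by positivity) huκ k
        rwa [mul_pow, ← Real.rpow_natCast ((n : ℝ) ^ (-a)), ← Real.rpow_mul hnpos.le,
          neg_mul] at this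
      have h2 : κ * n ≤ b := by
        rw [hκ, div_mul_eq_mul_div, one_mul, div_le_iff₀ (by positivity)]
        nlinarith
      calc κ ^ (h + 1) * (n : ℝ) ^ (-max 0 (a * (k : ℝ) - 1))
          ≤ κ ^ (k + 1) * (n : ℝ) ^ (1 + -(a * k)) := by
            refine mul_le_mul (pow_le_pow_of_le_one hκ0.le hκ1 (by omega)) ?_ (by positivity)
              (by positivity)
            refine Real.rpow_le_rpow_of_exponent_le hnR ?_
            linarith [le_max_right 0 (a * (k : ℝ) - 1)]
        _ = (κ * n) * (κ ^ k * (n : ℝ) ^ (-(a * k))) := by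
            rw [Real.rpow_add hnpos, Real.rpow_one]; ring
        _ ≤ b * u ^ k := by gcongr
  set q := (∏ i ∈ range h, (1 - (1 - u ^ (h - i)) ^ b)) ^ 2
  have hprod : (κ ^ (h + 1) / 2) ^ h * (n : ℝ) ^ (-S) ≤
      ∏ i ∈ range h, (1 - (1 - u ^ (h - i)) ^ b) := by
    refine le_trans (le_of_eq ?_) (prod_le_prod (fun i _ => by positivity) hfactor)
    rw [prod_mul_distrib, prod_const, card_range, ← Real.rpow_sum_of_pos hnpos, sum_neg_distrib]
  have hq : K * (n : ℝ) ^ (-(2 * S)) ≤ q := by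
    refine le_trans (le_of_eq ?_) (pow_le_pow_left₀ (by positivity) hprod 2)
    rw [mul_pow, ← Real.rpow_natCast ((n : ℝ) ^ (-S)), ← Real.rpow_mul hnpos.le]
    congr 2; push_cast; ring
  have hq1 : q ≤ 1 := by
    refine pow_le_one₀ (prod_nonneg fun i hi => le_trans (by positivity) (hfactor i hi)) ?_
    refine prod_le_one (fun i hi => le_trans (by positivity) (hfactor i hi)) fun i _ => ?_
    have : 0 ≤ (1 - u ^ (h - i)) ^ b := pow_nonneg (by linarith [pow_le_one₀ (n := h - i) hu0 hu1]) _
    linarith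
  refine lt_of_lt_of_le (half_lt_one_sub_one_sub_pow hq1 ?_)
    (le_prob_openEvent hd hb0 hbn hn0 hθ hp0 hp1)
  calc (1 : ℝ) ≤ K * (n : ℝ) ^ ((d : ℝ) - 2 - 2 * S) := hn1
    _ = ((n ^ (d - 2) : ℕ) : ℝ) * (K * (n : ℝ) ^ (-(2 * S))) := by
      rw [sub_eq_add_neg ((d : ℝ) - 2), Real.rpow_add hnpos]
      have : (n : ℝ) ^ ((d : ℝ) - 2) = ((n ^ (d - 2) : ℕ) : ℝ) := by
        rw [Nat.cast_pow, ← Real.rpow_natCast, Nat.cast_sub hd]; norm_num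
      rw [this]; ring
    _ ≤ _ := by gcongr

/-- With `z = θ ^ (-1/2)`, `sum_max_le` bounds the left side by a polynomial in `z` whose value at
`z = 0` is `c ^ 2 / 8`. -/
theorem eventually_nucleation_exponent_lt {c e : ℝ} (hc : 0 ≤ c) (he : c ^ 2 / 8 < e) :
    ∀ᶠ θ : ℕ in atTop, 2 * ∑ i ∈ range ((θ + 1) / 2),
      max 0 ((2 / (θ : ℝ) + c / (θ : ℝ) ^ (3 / 2 : ℝ)) * (((θ + 1) / 2 - i : ℕ) : ℝ) - 1) < e := by
  have hz : Tendsto (fun θ : ℕ => (√(θ : ℝ))⁻¹) atTop (nhds 0) :=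
    (Real.tendsto_sqrt_atTop.comp tendsto_natCast_atTop_atTop).inv_tendsto_atTop
  have hg : Continuous fun z : ℝ =>
      (c / 2 + z + c / 2 * z ^ 2) ^ 2 / 2 + 2 * (z * (c / 2 + z + c / 2 * z ^ 2)) := by fun_prop
  have hlim := (hg.tendsto 0).comp hz
  have h0 : (c / 2 + 0 + c / 2 * 0 ^ 2) ^ 2 / 2 + 2 * (0 * (c / 2 + 0 + c / 2 * 0 ^ 2)) < e := by
    nlinarith
  filter_upwards [hlim.eventually_lt_const h0, eventually_gt_atTop 0] with θ hθ hθ0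
  have hθR : (0 : ℝ) < θ := by exact_mod_cast hθ0
  refine lt_of_le_of_lt ?_ hθ
  simp only [Function.comp]
  set t := √(θ : ℝ) with ht
  have ht0 : 0 < t := Real.sqrt_pos.2 hθR
  have htt : (θ : ℝ) = t ^ 2 := (Real.sq_sqrt hθR.le).symm
  have h32 : (θ : ℝ) ^ (3 / 2 : ℝ) = t ^ 3 := by
    rw [htt, ← Real.rpow_natCast, ← Real.rpow_mul ht0.le, ← Real.rpow_natCast]; norm_num
  rw [h32, htt]
  set a := 2 / t ^ 2 + c / t ^ 3 with ha
  have ha0 : 0 < a := by positivity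
  set φ := c / 2 + t⁻¹ + c / 2 * t⁻¹ ^ 2 with hφ
  have hφ0 : 0 ≤ φ := by positivity
  have hF : max 0 (a * ((θ + 1) / 2 : ℕ) - 1) ≤ t⁻¹ * φ := by
    refine max_le (by positivity) ?_
    have h1 : (((θ + 1) / 2 : ℕ) : ℝ) ≤ (t ^ 2 + 1) / 2 := by
      rw [← htt]
      exact_mod_cast Nat.cast_div_le (α := ℝ) (m := θ + 1) (n := 2)
    have h2 : a * ((t ^ 2 + 1) / 2) - 1 = t⁻¹ * φ := by
      rw [ha, hφ]; field_simp; ring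
    rw [← h2]; gcongr
  have hF0 : 0 ≤ max 0 (a * ((θ + 1) / 2 : ℕ) - 1) := le_max_left _ _
  calc _ ≤ 2 * (max 0 (a * ((θ + 1) / 2 : ℕ) - 1) ^ 2 / (2 * a) +
        max 0 (a * ((θ + 1) / 2 : ℕ) - 1)) := by
        gcongr; exact sum_max_le ha0 _
    _ ≤ 2 * ((t⁻¹ * φ) ^ 2 / (2 * (2 / t ^ 2)) + t⁻¹ * φ) := by
        gcongr
        rw [ha]; linarith [show 0 ≤ c / t ^ 3 by positivity]
    _ = _ := by field_simp

end BootstrapPercolation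
-- A closed set that blocks the growth
namespace BootstrapPercolation
open Finset

section Obstruction
variable {n d θ T k : ℕ} {s : Finset (Fin d → Fin n)} {v w : Fin d → Fin n} {j j' : Fin d}

/-- The number of neighbours of `v` in direction `j` that belong to `s`. -/
def lineCount (s : Finset (Fin d → Fin n)) (v : Fin d → Fin n) (j : Fin d) : ℕ :=
  #{x | x ≠ v j ∧ Function.update v j x ∈ s}

/-- `v` has at least `T` neighbours in `s`. -/
def Rich (s : Finset (Fin d → Fin n)) (T : ℕ) (v : Fin d → Fin n) : Prop :=
  T ≤ ∑ j, lineCount s v j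

/-- `M` consists of points in a plane with directions `j`, `j'`, no two of them on a line. -/
structure IsPlaneMatching (j j' : Fin d) (M : Finset (Fin d → Fin n)) : Prop where
  coplanar : ∀ u ∈ M, ∀ v ∈ M, ∀ i, i ≠ j → i ≠ j' → u i = v i
  injOn_fst : ∀ u ∈ M, ∀ v ∈ M, u j = v j → u = v
  injOn_snd : ∀ u ∈ M, ∀ v ∈ M, u j' = v j' → u = v

open scoped Classical in
/-- The points of the line through `v` in direction `j` that are rich. -/
noncomputable def richOnLine (s : Finset (Fin d → Fin n)) (T : ℕ) (v : Fin d → Fin n)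
    (j : Fin d) : Finset (Fin n) := {x | Rich s T (Function.update v j x)}

/-- The line through `v` in direction `j` contains more than `2 * k` rich points. -/
def Heavy (s : Finset (Fin d → Fin n)) (T k : ℕ) (v : Fin d → Fin n) (j : Fin d) : Prop :=
  2 * k < #(richOnLine s T v j)

/-- The rich points together with `s` and all heavy lines. -/
def barrier (s : Finset (Fin d → Fin n)) (T k : ℕ) : Set (Fin d → Fin n) :=
  {v | v ∈ s ∨ Rich s T v ∨ ∃ j, Heavy s T k v j}

theorem heavy_update_iff {x : Fin n} : Heavy s T k (Function.update v j x) j ↔ Heavy s T k v j := by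
  have : richOnLine s T (Function.update v j x) j = richOnLine s T v j := by
    ext; simp [richOnLine]
  rw [Heavy, Heavy, this]

/-- No plane contains `k` rich points in general position. -/
def NoRichMatching (s : Finset (Fin d → Fin n)) (T k : ℕ) : Prop :=
  ∀ j j', j ≠ j' → ∀ M, IsPlaneMatching j j' M → (∀ v ∈ M, Rich s T v) → #M < k

/-- The rich points of a plane are covered by few lines. -/
theorem NoRichMatching.exists_cover (h : NoRichMatching s T k) (hj : j ≠ j') (w : Fin d → Fin n) :
    ∃ X X' : Finset (Fin n), #X ≤ k ∧ #X' ≤ k ∧ ∀ v, Rich s T v →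
      (∀ i, i ≠ j → i ≠ j' → v i = w i) → v j ∈ X ∨ v j' ∈ X' := by
  classical
  -- A largest matching of rich points in the plane: a rich point sharing neither coordinate with it
  -- could be added.
  obtain ⟨M, hM, hmax⟩ := exists_max_image
    (univ.filter fun M : Finset (Fin d → Fin n) => IsPlaneMatching j j' M ∧
      (∀ v ∈ M, Rich s T v) ∧ ∀ v ∈ M, ∀ i, i ≠ j → i ≠ j' → v i = w i) card
    ⟨∅, by simp only [mem_filter_univ]; exact ⟨⟨by simp, by simp, by simp⟩, by simp, by simp⟩⟩
  simp only [mem_filter, mem_univ, true_and] at hM hmax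
  obtain ⟨hM, hrich, hw⟩ := hM
  have hk := h j j' hj M hM hrich
  refine ⟨M.image (· j), M.image (· j'), card_image_le.trans hk.le, card_image_le.trans hk.le, ?_⟩
  intro v hv hvw
  by_contra! hcon
  simp only [mem_image, not_exists, not_and] at hcon
  obtain ⟨h1, h2⟩ := hcon
  have hvM : v ∉ M := fun hm => h1 v hm rfl
  have := hmax (insert v M) ⟨⟨?_, ?_, ?_⟩, ?_, ?_⟩
  · rw [card_insert_of_notMem hvM] at this; omega
  · have hw' : ∀ u ∈ insert v M, ∀ i, i ≠ j → i ≠ j' → u i = w i := by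
      intro u hu
      rcases mem_insert.1 hu with rfl | hu
      exacts [hvw, hw u hu]
    intro u hu u' hu' i hi hi'
    rw [hw' u hu i hi hi', hw' u' hu' i hi hi']
  · intro u hu u' hu' e
    rcases mem_insert.1 hu with rfl | ha <;> rcases mem_insert.1 hu' with rfl | hb
    exacts [rfl, (h1 u' hb e.symm).elim, (h1 u ha e).elim, hM.injOn_fst u ha u' hb e]
  · intro u hu u' hu' e
    rcases mem_insert.1 hu with rfl | ha <;> rcases mem_insert.1 hu' with rfl | hb
    exacts [rfl, (h2 u' hb e.symm).elim, (h2 u ha e).elim, hM.injOn_snd u ha u' hb e]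
  · intro u hu
    rcases mem_insert.1 hu with rfl | hu
    exacts [hv, hrich u hu]
  · intro u hu
    rcases mem_insert.1 hu with rfl | hu
    exacts [hvw, hw u hu]

/-- Among the parallel lines in direction `j'` of a plane, few are heavy. -/
theorem NoRichMatching.exists_heavy_cover (h : NoRichMatching s T k) (hj : j ≠ j')
    (w : Fin d → Fin n) :
    ∃ X : Finset (Fin n), #X ≤ k ∧ ∀ x, Heavy s T k (Function.update w j x) j' → x ∈ X := by
  obtain ⟨X, X', hX, hX', hcov⟩ := h.exists_cover hj w
  refine ⟨X, hX, fun x hx => ?_⟩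
  by_contra hxX
  -- Off `X`, the rich points of the line must be covered by `X'`, so there are at most `k`.
  have hsub : richOnLine s T (Function.update w j x) j' ⊆ X' := by
    intro y hy
    simp only [richOnLine, mem_filter, mem_univ, true_and] at hy
    rcases hcov _ hy (fun i hi hi' => by simp [hi, hi']) with h1 | h1
    · simp [hj] at h1
      exact (hxX h1).elim
    · simpa using h1
  have := card_le_card hsub
  unfold Heavy at hx
  omega

-- A barrier point of a non-heavy line is in `s`, or is one of at most `2 * k` rich points, or lies
-- on a heavy line in another direction. For each such direction, the heavy lines of the common
-- plane meet the given line in at most `k` points.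
open scoped Classical in
theorem NoRichMatching.card_barrier_le (h : NoRichMatching s T k) (hv : ¬ Heavy s T k v j)
    (A : Finset (Fin n)) :
    #{x ∈ A | Function.update v j x ∈ barrier s T k} ≤
      #{x ∈ A | Function.update v j x ∈ s} + (2 * k + d * k) := by
  have hX : ∀ j' : Fin d, ∃ X : Finset (Fin n), #X ≤ k ∧
      (j ≠ j' → ∀ x, Heavy s T k (Function.update v j x) j' → x ∈ X) := by
    intro j'
    by_cases hj : j = j'
    · exact ⟨∅, by simp, fun hne => (hne hj).elim⟩
    · obtain ⟨X, h1, h2⟩ := h.exists_heavy_cover hj v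
      exact ⟨X, h1, fun _ => h2⟩
  choose X hXk hX using hX
  have hsub : {x ∈ A | Function.update v j x ∈ barrier s T k} ⊆
      {x ∈ A | Function.update v j x ∈ s} ∪ (richOnLine s T v j ∪ univ.biUnion X) := by
    intro x hx
    obtain ⟨hxA, hx | hx | ⟨j', hx⟩⟩ := mem_filter.1 hx
    · exact mem_union_left _ (mem_filter.2 ⟨hxA, hx⟩)
    · exact mem_union_right _ (mem_union_left _ (by simpa [richOnLine] using hx))
    · refine mem_union_right _ (mem_union_right _ (mem_biUnion.2 ⟨j', mem_univ _, hX j' ?_ x hx⟩))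
      rintro rfl
      exact hv (heavy_update_iff.1 hx)
  have h1 : #(univ.biUnion X) ≤ d * k := by
    simpa using card_biUnion_le_card_mul univ X k fun j' _ => hXk j'
  have h2 : #(richOnLine s T v j) ≤ 2 * k := not_lt.1 hv
  have := card_le_card hsub
  have := card_union_le {x ∈ A | Function.update v j x ∈ s}
    (richOnLine s T v j ∪ univ.biUnion X)
  have := card_union_le (richOnLine s T v j) (univ.biUnion X)
  omega

/-- The barrier is closed: a vertex outside it has fewer than `T` neighbours in `s`, and each of the
`d` lines through it, none heavy, adds at most `2 * k + d * k` more. -/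
theorem NoRichMatching.finalConfig_subset_barrier (h : NoRichMatching s T k) (hd : 2 ≤ d)
    (hT : T + 2 * d ^ 2 * k ≤ θ) :
    finalConfig (hammingTorus n d) θ (s : Set (Fin d → Fin n)) ⊆ barrier s T k := by
  classical
  refine finalConfig_subset_of_closed (fun v hv => Or.inl hv) fun v hv => ?_
  simp only [barrier, Set.mem_ofPred_eq, not_or, not_exists] at hv
  obtain ⟨-, hrich, hheavy⟩ := hv
  set A : Fin d → Finset (Fin n) := fun j =>
    {x ∈ univ.filter (· ≠ v j) | Function.update v j x ∈ barrier s T k} with hA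
  have hsub : (hammingTorus n d).neighborSet v ∩ barrier s T k ⊆
      ((univ.biUnion fun j => (A j).image (Function.update v j) : Finset (Fin d → Fin n)) :
        Set (Fin d → Fin n)) := by
    rintro u ⟨hu, huB⟩
    obtain ⟨j, x, hx, rfl⟩ := hammingTorus_adj_iff.1 hu
    exact mem_coe.2 (mem_biUnion.2 ⟨j, mem_univ _, mem_image_of_mem _ (by simp [A, hx, huB])⟩)
  refine (Set.encard_le_encard hsub).trans_lt ?_
  rw [Set.encard_coe_eq_coe_finsetCard]
  have hcard : ∀ j, #((A j).image (Function.update v j)) ≤ lineCount s v j + (2 * k + d * k) := by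
    intro j
    refine card_image_le.trans ((h.card_barrier_le (hheavy j) _).trans_eq ?_)
    rw [lineCount, filter_filter]
  have : #(univ.biUnion fun j => (A j).image (Function.update v j)) < θ := by
    calc _ ≤ ∑ j, #((A j).image (Function.update v j)) := card_biUnion_le
      _ ≤ ∑ j, (lineCount s v j + (2 * k + d * k)) := sum_le_sum fun j _ => hcard j
      _ = ∑ j, lineCount s v j + d * (2 * k + d * k) := by simp [sum_add_distrib]
      _ < T + d * (2 * k + d * k) := by
        unfold Rich at hrich; omega
      _ ≤ T + 2 * d ^ 2 * k := by nlinarith [Nat.mul_le_mul_right (d * k) hd]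
      _ ≤ θ := hT
  exact_mod_cast this

/-- An open plane would contain a non-heavy line inside the barrier. Nearly all of that line is in
`s`, so all its points are rich and the line is heavy after all. -/
theorem NoRichMatching.notMem_openEvent (h : NoRichMatching s T k) (hd : 2 ≤ d)
    (hT : T + 2 * d ^ 2 * k ≤ θ) (hn : θ < n) : s ∉ openEvent n d θ 2 := by
  classical
  rintro ⟨_, ⟨I, w, hI, rfl⟩, hS⟩
  obtain ⟨j, j', hj, rfl⟩ := card_eq_two.1 hI
  have hdk : 2 * k + d * k ≤ 2 * d ^ 2 * k := by nlinarith [Nat.mul_le_mul_right k hd]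
  obtain ⟨X, hX, hXh⟩ := h.exists_heavy_cover hj.symm w
  obtain ⟨y, hy⟩ : ∃ y, y ∉ X := by
    by_contra! hall
    have : #(univ : Finset (Fin n)) ≤ #X := card_le_card fun y _ => hall y
    rw [card_univ, Fintype.card_fin] at this
    omega
  set v := Function.update w j' y
  have hv : ¬ Heavy s T k v j := fun hh => hy (hXh y hh)
  have hmem : ∀ x, Function.update v j x ∈ barrier s T k := by
    refine fun x => h.finalConfig_subset_barrier hd hT (hS fun i hi => ?_)
    simp only [mem_insert, mem_singleton, not_or] at hi
    simp [v, hi.1, hi.2]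
  have hcard := h.card_barrier_le hv univ
  simp only [hmem, filter_true, card_univ, Fintype.card_fin] at hcard
  have hrich : ∀ x, Rich s T (Function.update v j x) := by
    intro x
    refine le_trans ?_ (single_le_sum (fun _ _ => Nat.zero_le _) (mem_univ j))
    have hline : ({x | Function.update v j x ∈ s} : Finset (Fin n)).erase x ⊆
        ({x' | x' ≠ Function.update v j x j ∧
          Function.update (Function.update v j x) j x' ∈ s} : Finset (Fin n)) := by
      intro x'
      simp
    have := card_le_card hline
    have := pred_card_le_card_erase (s := ({x | Function.update v j x ∈ s} : Finset (Fin n))) (a := x)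
    unfold lineCount
    omega
  refine hv ?_
  simp only [Heavy, richOnLine, hrich, filter_true, card_univ, Fintype.card_fin]
  omega

end Obstruction
end BootstrapPercolation
-- First moment bound for rich matchings
namespace BootstrapPercolation
open Finset Filter

section FirstMoment
variable {n d θ T k N : ℕ} {s : Finset (Fin d → Fin n)} {j j' : Fin d}

/-- The data describing `k` points of a plane and `N` neighbours of each of them. -/
abbrev MatchingData (n d k N : ℕ) : Type :=
  (Fin d × Fin d) × (Fin d → Fin n) × (Fin k → Fin n × Fin n) × (Fin k × Fin N → Fin d × Fin n)

/-- The neighbours described by matching data. -/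
def MatchingData.point (ξ : MatchingData n d k N) (z : Fin k × Fin N) : Fin d → Fin n :=
  Function.update (cell ξ.1.1 ξ.1.2 ξ.2.1 (ξ.2.2.1 z.1).1 (ξ.2.2.1 z.1).2) (ξ.2.2.2 z).1
    (ξ.2.2.2 z).2

/-- The occupied directions and positions around `v`. -/
def occupied (s : Finset (Fin d → Fin n)) (v : Fin d → Fin n) : Finset (Fin d × Fin n) :=
  {z | z.2 ≠ v z.1 ∧ Function.update v z.1 z.2 ∈ s}

theorem mem_occupied {v : Fin d → Fin n} {z : Fin d × Fin n} :
    z ∈ occupied s v ↔ z.2 ≠ v z.1 ∧ Function.update v z.1 z.2 ∈ s := by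
  simp [occupied]

theorem card_occupied (s : Finset (Fin d → Fin n)) (v : Fin d → Fin n) :
    #(occupied s v) = ∑ j, lineCount s v j := by
  simp only [occupied, lineCount, card_filter, Fintype.sum_prod_type]

/-- Points differing in two coordinates can share only the two opposite corners of their rectangle
as neighbours. -/
theorem eq_of_update_eq_update {v v' : Fin d → Fin n} {l l' : Fin d} {x x' : Fin n}
    (hj : j ≠ j') (h1 : v j ≠ v' j) (h2 : v j' ≠ v' j')
    (h : Function.update v l x = Function.update v' l' x') :
    (l, x) = (j, v' j) ∨ (l, x) = (j', v' j') := by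
  have e1 := congrFun h j
  have e2 := congrFun h j'
  by_cases a1 : j = l
  · subst a1
    by_cases a2 : j = l'
    · subst a2
      rw [Function.update_of_ne hj.symm, Function.update_of_ne hj.symm] at e2
      exact (h2 e2).elim
    · rw [Function.update_self, Function.update_of_ne a2] at e1
      exact Or.inl (by rw [e1])
  · rw [Function.update_of_ne a1] at e1
    have a2 : j = l' := by
      by_contra a2
      rw [Function.update_of_ne a2] at e1
      exact h1 e1
    subst a2
    rw [Function.update_of_ne hj.symm (f := v')] at e2
    by_cases a3 : j' = l
    · subst a3
      rw [Function.update_self] at e2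
      exact Or.inr (by rw [e2])
    · rw [Function.update_of_ne a3] at e2
      exact (h2 e2).elim

theorem update_injective_of_ne {v : Fin d → Fin n} {l l' : Fin d} {x x' : Fin n}
    (hx : x ≠ v l) (h : Function.update v l x = Function.update v l' x') :
    (l, x) = (l', x') := by
  have e := congrFun h l
  rw [Function.update_self] at e
  by_cases a : l = l'
  · subst a
    rw [Function.update_self] at e
    rw [e]
  · rw [Function.update_of_ne a] at e
    exact (hx e).elim

/-- Discarding the at most `2 * k` positions that could give shared neighbours leaves each of the
`k` rich points `N` private ones. -/
theorem exists_matchingData (hk : 0 < k) (hT : N + 2 * k ≤ T) (h : ¬ NoRichMatching s T k) :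
    ∃ ξ : MatchingData n d k N, Function.Injective ξ.point ∧ univ.image ξ.point ⊆ s := by
  simp only [NoRichMatching, not_forall, not_lt] at h
  obtain ⟨j, j', hj, M, hM, hrich, hcard⟩ := h
  obtain ⟨e⟩ : Nonempty (Fin k ↪ M) := Function.Embedding.nonempty_of_card_le (by simpa using hcard)
  set v : Fin k → Fin d → Fin n := fun i => e i with hv
  have hvM : ∀ i, v i ∈ M := fun i => (e i).2
  have hne : ∀ i i', i ≠ i' → v i ≠ v i' := fun i i' hi he => hi (e.injective (Subtype.ext he))
  have hne1 : ∀ i i', i ≠ i' → v i j ≠ v i' j := fun i i' hi he =>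
    hne i i' hi (hM.injOn_fst _ (hvM i) _ (hvM i') he)
  have hne2 : ∀ i i', i ≠ i' → v i j' ≠ v i' j' := fun i i' hi he =>
    hne i i' hi (hM.injOn_snd _ (hvM i) _ (hvM i') he)
  set X : Finset (Fin d × Fin n) := univ.biUnion fun i => {(j, v i j), (j', v i j')} with hX
  have hXcard : #X ≤ 2 * k := by
    refine (card_biUnion_le_card_mul _ _ 2 fun i _ => card_le_two).trans ?_
    rw [card_univ, Fintype.card_fin, mul_comm]
  have hD : ∀ i, N ≤ #(occupied s (v i) \ X) := by
    intro i
    have h1 := le_card_sdiff X (occupied s (v i))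
    rw [card_occupied] at h1
    have h2 := hrich _ (hvM i)
    unfold Rich at h2
    omega
  have hE : ∀ i, Nonempty (Fin N ↪ (occupied s (v i) \ X : Finset (Fin d × Fin n))) := fun i =>
    Function.Embedding.nonempty_of_card_le (by simpa only [Fintype.card_fin, Fintype.card_coe] using hD i)
  let f := fun i => (hE i).some
  set g : Fin k × Fin N → Fin d × Fin n := fun z => f z.1 z.2 with hg
  have hgo : ∀ z, (g z).2 ≠ v z.1 (g z).1 ∧ Function.update (v z.1) (g z).1 (g z).2 ∈ s := by
    intro z
    exact mem_occupied.1 (mem_sdiff.1 (f z.1 z.2).2).1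
  have hgX : ∀ z i, g z ≠ (j, v i j) ∧ g z ≠ (j', v i j') := by
    intro z i
    have := (mem_sdiff.1 (f z.1 z.2).2).2
    simp only [hX, mem_biUnion, mem_univ, true_and, mem_insert, mem_singleton, not_exists,
      not_or] at this
    exact this i
  let ξ : MatchingData n d k N := ((j, j'), v ⟨0, hk⟩, fun i => (v i j, v i j'), g)
  have hξ : ∀ z, ξ.point z = Function.update (v z.1) (g z).1 (g z).2 := by
    intro z
    have : cell j j' (v ⟨0, hk⟩) (v z.1 j) (v z.1 j') = v z.1 := by
      funext l
      by_cases h1 : l = j'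
      · subst h1; exact cell_snd
      by_cases h0 : l = j
      · subst h0; exact cell_fst hj
      rw [cell_of_ne h0 h1]
      exact hM.coplanar _ (hvM _) _ (hvM _) l h0 h1
    change Function.update (cell j j' (v ⟨0, hk⟩) (v z.1 j) (v z.1 j')) (g z).1 (g z).2 = _
    rw [this]
  refine ⟨ξ, ?_, ?_⟩
  · intro z z' hz
    rw [hξ, hξ] at hz
    by_cases hi : z.1 = z'.1
    · obtain ⟨i, a⟩ := z
      obtain ⟨i', a'⟩ := z'
      obtain rfl : i = i' := hi
      have := update_injective_of_ne (hgo (i, a)).1 hz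
      have h2 : f i a = f i a' := Subtype.ext this
      rw [(f i).injective h2]
    · rcases eq_of_update_eq_update hj (hne1 _ _ hi) (hne2 _ _ hi) hz with h1 | h1
      · exact ((hgX z z'.1).1 h1).elim
      · exact ((hgX z z'.1).2 h1).elim
  · intro u hu
    obtain ⟨z, -, rfl⟩ := mem_image.1 hu
    rw [hξ]
    exact (hgo z).2

/-- Union bound over matching data, with `T = N + 2 * k`. Of the slack, `2 * d ^ 2 * k` pays for the
barrier and `2 * k` for shared neighbours. -/
theorem prob_openEvent_le (hd : 2 ≤ d) (hk : 0 < k) (hN : N + (2 * d ^ 2 + 2) * k ≤ θ) (hn : θ < n)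
    {p : ℝ} (hp0 : 0 ≤ p) (hp1 : p ≤ 1) :
    bernoulliProb p (openEvent n d θ 2) ≤
      (d : ℝ) ^ 2 * (n : ℝ) ^ d * (n : ℝ) ^ (2 * k) * (d * n * p) ^ (k * N) := by
  classical
  set F : MatchingData n d k N → Set (Finset (Fin d → Fin n)) := fun ξ =>
    {s | Function.Injective ξ.point ∧ univ.image ξ.point ⊆ s} with hF
  have hsub : openEvent n d θ 2 ⊆ ⋃ ξ ∈ (univ : Finset (MatchingData n d k N)), F ξ := by
    intro s hs
    have h : ¬ NoRichMatching s (N + 2 * k) k := fun h =>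
      h.notMem_openEvent hd (by nlinarith) hn hs
    obtain ⟨ξ, hξ⟩ := exists_matchingData hk le_rfl h
    exact Set.mem_biUnion (mem_univ ξ) hξ
  have hprob : ∀ ξ, bernoulliProb p (F ξ) ≤ p ^ (k * N) := by
    intro ξ
    by_cases hξ : Function.Injective ξ.point
    · have : F ξ = {s | univ.image ξ.point ⊆ s} := by simp [hF, hξ]
      rw [this, BernoulliSubset.prob_superset, card_image_of_injective _ hξ]
      simp
    · have : F ξ = ∅ := by simp [hF, hξ]
      rw [this]
      simp only [bernoulliProb, Set.mem_empty_iff_false, if_false, sum_const_zero]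
      positivity
  calc _ ≤ _ := BernoulliSubset.prob_mono hp0 hp1 hsub
    _ ≤ _ := BernoulliSubset.prob_biUnion_le hp0 hp1 _ _
    _ ≤ ∑ _ξ : MatchingData n d k N, p ^ (k * N) := sum_le_sum fun ξ _ => hprob ξ
    _ = _ := by
      simp [card_univ, Fintype.card_prod, mul_pow, pow_mul]
      ring

theorem eventually_prob_openEvent_lt_half (hd : 2 ≤ d) (hk : 0 < k)
    (hN : N + (2 * d ^ 2 + 2) * k ≤ θ) {a : ℝ} (ha : (d : ℝ) + 2 * k < a * (k * N)) :
    ∀ᶠ n : ℕ in atTop, ∀ p : ℝ, 0 ≤ p → p ≤ 1 → p ≤ (n : ℝ) ^ (-1 - a) →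
      bernoulliProb p (openEvent n d θ 2) < 1 / 2 := by
  have hlim : Tendsto (fun n : ℕ => (d : ℝ) ^ 2 * (d : ℝ) ^ (k * N) *
      (n : ℝ) ^ (-(a * (k * N) - (d + 2 * k)))) atTop (nhds 0) := by
    rw [← mul_zero ((d : ℝ) ^ 2 * (d : ℝ) ^ (k * N))]
    exact ((tendsto_rpow_neg_atTop (by linarith)).comp tendsto_natCast_atTop_atTop).const_mul _
  filter_upwards [hlim.eventually_lt_const (show (0 : ℝ) < 1 / 2 by norm_num),
    eventually_gt_atTop θ] with n hn1 hn p hp0 hp1 hp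
  refine (prob_openEvent_le hd hk hN hn hp0 hp1).trans_lt (lt_of_le_of_lt ?_ hn1)
  have hnpos : (0 : ℝ) < n := by exact_mod_cast (Nat.zero_le θ).trans_lt hn
  have hnp : n * p ≤ (n : ℝ) ^ (-a) := by
    calc n * p ≤ (n : ℝ) ^ (1 : ℝ) * (n : ℝ) ^ (-1 - a) := by rw [Real.rpow_one]; gcongr
      _ = _ := by rw [← Real.rpow_add hnpos]; congr 1; ring
  calc _ = (d : ℝ) ^ 2 * (d : ℝ) ^ (k * N) * ((n : ℝ) ^ d * (n : ℝ) ^ (2 * k) *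
        (n * p) ^ (k * N)) := by rw [mul_assoc (d : ℝ) n p, mul_pow (d : ℝ)]; ring
    _ ≤ (d : ℝ) ^ 2 * (d : ℝ) ^ (k * N) * ((n : ℝ) ^ d * (n : ℝ) ^ (2 * k) *
        ((n : ℝ) ^ (-a)) ^ (k * N)) := by gcongr
    _ = _ := by
      congr 1
      rw [← Real.rpow_natCast, ← Real.rpow_natCast, ← Real.rpow_natCast, ← Real.rpow_mul hnpos.le,
        ← Real.rpow_add hnpos, ← Real.rpow_add hnpos]
      congr 1
      push_cast
      ring

end FirstMoment

theorem exists_matching_size (d : ℕ) (hd : 3 ≤ d) : ∃ θ₀ : ℕ, ∀ θ : ℕ, θ₀ ≤ θ → ∃ k N : ℕ,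
    0 < k ∧ N + (2 * d ^ 2 + 2) * k ≤ θ ∧ (d : ℝ) + 2 * k <
      (2 / (θ : ℝ) + (4 * (d : ℝ) ^ 2 + 3) / (θ : ℝ) ^ (3 / 2 : ℝ)) * (k * N) := by
  -- This makes `c * m ≤ √θ`, which keeps the error term `c * m / t * r` at most 1/2.
  refine ⟨((4 * d ^ 2 + 3) * (2 * d ^ 2 + 2)) ^ 2, fun θ hθ => ?_⟩
  have hdR : (3 : ℝ) ≤ d := by exact_mod_cast hd
  set m : ℝ := 2 * d ^ 2 + 2 with hm
  set c : ℝ := 4 * d ^ 2 + 3 with hc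
  have hm0 : 20 ≤ m := by rw [hm]; nlinarith
  have hc0 : 39 ≤ c := by rw [hc]; nlinarith
  set t := √(θ : ℝ) with ht
  have hct : c * m ≤ t := by
    refine Real.le_sqrt_of_sq_le ?_
    rw [hc, hm]; exact_mod_cast hθ
  have ht4 : 780 ≤ t := by nlinarith
  have ht0 : 0 < t := by linarith
  have htt : (θ : ℝ) = t ^ 2 := (Real.sq_sqrt (Nat.cast_nonneg θ)).symm
  have h32 : (θ : ℝ) ^ (3 / 2 : ℝ) = t ^ 3 := by
    rw [htt, ← Real.rpow_natCast, ← Real.rpow_mul ht0.le, ← Real.rpow_natCast]; norm_num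
  set k := ⌊t / 2⌋₊ with hk
  have hk1 : (k : ℝ) ≤ t / 2 := Nat.floor_le (by positivity)
  have hk2 : t / 4 ≤ k := by
    have := Nat.lt_floor_add_one (t / 2)
    rw [← hk] at this
    linarith
  have hmk : m * k ≤ t ^ 2 := by nlinarith
  have hmkN : (2 * d ^ 2 + 2) * k ≤ θ := by
    have : (((2 * d ^ 2 + 2) * k : ℕ) : ℝ) ≤ (θ : ℝ) := by
      rw [htt]; push_cast; exact hmk
    exact_mod_cast this
  refine ⟨k, θ - (2 * d ^ 2 + 2) * k, ?_, by omega, ?_⟩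
  · have : (0 : ℝ) < k := by linarith
    exact_mod_cast this
  have hN : ((θ - (2 * d ^ 2 + 2) * k : ℕ) : ℝ) = t ^ 2 - m * k := by
    rw [Nat.cast_sub hmkN, ← htt]; push_cast; rfl
  rw [h32, hN, htt]
  set r : ℝ := k / t with hr
  have hkr : (k : ℝ) = r * t := by rw [hr]; field_simp
  have hr1 : r ≤ 1 / 2 := by rw [hr, div_le_iff₀ ht0]; linarith
  have hr2 : 1 / 4 ≤ r := by rw [hr, le_div_iff₀ ht0]; linarith
  -- The terms `2 * k` cancel in the goal. As `1/4 ≤ r ≤ 1/2`, the rest is at least `2 * d ^ 2 / 4`,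
  -- which exceeds `d` for `d ≥ 3`.
  have e : (2 / t ^ 2 + c / t ^ 3) * (k * (t ^ 2 - m * k)) =
      2 * k + r * (c - 2 * m * r - c * m / t * r) := by
    rw [hkr]; field_simp; ring
  have hcm : c * m / t ≤ 1 := by rw [div_le_one ht0]; exact hct
  have hcm0 : 0 ≤ c * m / t := by positivity
  have h1 : 2 * (d : ℝ) ^ 2 ≤ c - 2 * m * r - c * m / t * r := by
    have : c * m / t * r ≤ 1 / 2 := by nlinarith
    have : 2 * m * r ≤ m := by nlinarith
    rw [hc, hm] at *; linarith
  rw [e]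
  nlinarith

end BootstrapPercolation

/-! ### Conclusion -/

theorem theorem2p4 (d : ℕ) (hd : 3 ≤ d) :
    ∃ θ₀ : ℕ, ∀ θ : ℕ, θ₀ ≤ θ → ∃ n₀ : ℕ, ∀ n : ℕ, n₀ ≤ n →
      (∃! p : unitInterval, BootstrapPercolation.IsCriticalProb n d θ 2 p) ∧
      ∀ p : unitInterval, BootstrapPercolation.IsCriticalProb n d θ 2 p →
        (n : ℝ) ^ (-1 - 2 / (θ : ℝ) - (4 * (d : ℝ) ^ 2 + 3) / (θ : ℝ) ^ (3 / 2 : ℝ)) ≤ (p : ℝ) ∧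
        (p : ℝ) ≤
          (n : ℝ) ^ (-1 - 2 / (θ : ℝ) - √(8 * ((d : ℝ) - 2.1)) / (θ : ℝ) ^ (3 / 2 : ℝ)) := by
  have hdR : (3 : ℝ) ≤ d := by exact_mod_cast hd
  have hd2 : 2 ≤ d := by omega
  set c := √(8 * ((d : ℝ) - 2.1)) with hc
  -- The only role of 2.1 is to exceed 2, so that the `n ^ (d - 2)` planes beat the cost of a
  -- nucleus.
  have hcsq : c ^ 2 / 8 < d - 2 := by
    rw [hc, Real.sq_sqrt (by linarith)]; linarith
  obtain ⟨θ₁, hθ₁⟩ := Filter.eventually_atTop.1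
    (BootstrapPercolation.eventually_nucleation_exponent_lt (Real.sqrt_nonneg _) hcsq)
  obtain ⟨θ₂, hθ₂⟩ := BootstrapPercolation.exists_matching_size d hd
  refine ⟨max 1 (max θ₁ θ₂), fun θ hθ => ?_⟩
  simp only [max_le_iff] at hθ
  obtain ⟨hθ, h1, h2⟩ := hθ
  have hθR : (0 : ℝ) < θ := by exact_mod_cast hθ
  obtain ⟨k, N, hk, hN, hkN⟩ := hθ₂ θ h2
  have hup := BootstrapPercolation.eventually_half_lt_prob_openEvent (d := d) (θ := θ)
    (h := (θ + 1) / 2) hd2 (by omega) (by omega)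
    (a := 2 / (θ : ℝ) + c / (θ : ℝ) ^ (3 / 2 : ℝ)) (by positivity) (hθ₁ θ h1)
  have hlo := BootstrapPercolation.eventually_prob_openEvent_lt_half hd2 hk hN hkN
  obtain ⟨n₀, hn₀⟩ := Filter.eventually_atTop.1
    ((hup.and hlo).and (Filter.eventually_gt_atTop 0))
  refine ⟨n₀, fun n hn => ?_⟩
  obtain ⟨⟨hup, hlo⟩, hn0⟩ := hn₀ n hn
  refine ⟨BootstrapPercolation.existsUnique_isCriticalProb hn0 hθ hd2, fun p hp => ?_⟩
  rw [BootstrapPercolation.IsCriticalProb, BootstrapPercolation.openProb_eq] at hp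
  rw [sub_sub, sub_sub]
  constructor
  · by_contra! hlt
    exact (hlo p p.2.1 p.2.2 hlt.le).ne hp
  · by_contra! hlt
    set p' : ℝ := (n : ℝ) ^ (-1 - (2 / (θ : ℝ) + c / (θ : ℝ) ^ (3 / 2 : ℝ)))
    have hp' : p' ∈ unitInterval := ⟨by positivity, hlt.le.trans p.2.2⟩
    have := BootstrapPercolation.openProb_strictMono (n := n) (d := d) hn0 hθ hd2
      (show (⟨p', hp'⟩ : unitInterval) < p from hlt)
    rw [BootstrapPercolation.openProb_eq, BootstrapPercolation.openProb_eq, hp] at this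
    exact lt_asymm this hup
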